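/- **SOP lower bound, Scenario II (eavesdropping on the RIS-aided underwater optical link).** Let $\mathcal R_s>0$ and $\phi=2^{\mathcal R_s}$. *RF hop.* Let $\kappa,\mu,\alpha,D,\varrho,\bar\gamma>0$, let $L,p\ge1$ be integers, and put $\mu_L=L\mu$, $B=\mu_L(1+\kappa)$, $A=\frac{2\mu_L(1+\kappa)^{(\mu_L+1)/2}}{\kappa^{(\mu_L-1)/2}e^{\mu_L\kappa}}$, $M=2\mu_L\sqrt{\kappa(1+\kappa)}$. The SNR at the relay is $\gamma_R=\varrho\,q^{-\alpha}L\bar\gamma\,W$ with $q$ and $W$ independent, where $q$ has the random-waypoint density $\sum_{i=1}^3 C_i D^{-\beta_i-1}q^{\beta_i}$ on $(0,D]$, $(C_i)=\frac1{72}(735,-1190,455)$, $(\beta_i)=(2,4,6)$, and $W$ is the power of a $\kappa$-$\mu$ fading coefficient at the output of the $L$-branch MRC combiner, with density $$\tfrac A2\,(\sqrt w)^{\mu_L-1}e^{-Bw}\sum_{k=0}^pV(k,p,\mu_L-1)\Big(\frac{M\sqrt w}2\Big)^{\mu_L-1+2k},\quad w>0,\qquad V(k,p,v)=\frac{\Gamma(p+k)\,p^{1-2k}}{\Gamma(k+1)\Gamma(p-k+1)\Gamma(v+k+1)},$$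 in which the sum is the order-$p$ approximation of the Bessel function $I_{\mu_L-1}(M\sqrt w)$. Let $F_{\gamma_R}(x)=\Pr(\gamma_R\le x)$, computed with these densities. *Optical hop.* For each receiver $n\in\{\mathcal D,\tilde{\mathcal E}\}$ (destination, eavesdropper) let $Y_n=\alpha_n\beta_n$ be the product of two independent channel gains, each of which is the product of an independent mEGG turbulence gain (density $\frac{\omega}{\nu}e^{-x/\nu}+(1-\omega)\frac{c\,x^{ac-1}}{b^{ac}\Gamma(a)}e^{-(x/b)^c}$ on $x>0$, with $0<\omega<1$ and $\nu,a,b,c>0$) and a pointing-error gain (density $\xi^2J^{-\xi^2}x^{\xi^2-1}$ on $(0,J]$, with $\xi,J>0$); the parameters may differ from channel to channel. With $\mathcal N\ge1$ reflecting elements, $\chi_n$, the sum of $\mathcal N$ independent copies of $Y_n$, is modelled as a gamma variable with the same mean and variance, i.e. with shape $\rho_n=\frac{(\mathcal N\,\mathbb E Y_n)^2}{\mathcal N\operatorname{Var}Y_n}$ and scale $w_n=\frac{\mathcal N\operatorname{Var}Y_n}{\mathcal N\,\mathbb EY_n}$. For a detection method $r_n\in\{1,2\}$, conversion coefficient $\eta>0$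 and noise power $N_n>0$ put $\tau_n=(\eta\,\mathbb EY_n)^{r_n}/N_n$; the SNR is $\gamma_n=\tau_n(\chi_n/\mathbb EY_n)^{r_n}$, with CDF $F_{\gamma_n}$ and density $f_{\gamma_n}$. ($\mathcal N$ and $\eta$ may depend on $n$.) *Secrecy outage.* With the notation $$SOP^{II}=\int_0^\infty F_{\gamma_{\mathcal D}}(\phi\gamma+\phi-1)f_{\gamma_{\tilde{\mathcal E}}}(\gamma)\,d\gamma\,\bigl(1-F_{\gamma_R}(\phi-1)\bigr)+F_{\gamma_R}(\phi-1),$$ $$SOP^{II}_L=\int_0^\infty F_{\gamma_{\mathcal D}}(\phi\gamma)f_{\gamma_{\tilde{\mathcal E}}}(\gamma)\,d\gamma\,\bigl(1-F_{\gamma_R}(\phi-1)\bigr)+F_{\gamma_R}(\phi-1),$$ one has $SOP^{II}\ge SOP^{II}_L$ and $$SOP_L^{II}=\Upsilon_3'\,\Upsilon_1\,\frac{r_{\tilde{\mathcal E}}^{1/2}(\Upsilon_4')^{-\zeta}}{(2\pi)^{(r_{\tilde{\mathcal E}}-1)/2}}\;G^{\,r_{\tilde{\mathcal E}}+1,\;r_{\mathcal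 D}}_{\,r_{\mathcal D}+1,\;r_{\tilde{\mathcal E}}+1}\!\left[\Omega_{18}\,\middle|\,{S\atop S'}\right]\,(1-\mathcal F)+\mathcal F,$$ $$\mathcal F=\sum_{i=1}^{3}\sum_{k=0}^{p}K_{1}\,G^{1,2}_{2,3}\!\left[K_2(\phi-1)\,\middle|\,{1-\Psi_i,\;1\atop L\mu+k,\;0,\;-\Psi_i}\right].$$ Here $G$ is the Meijer $G$-function (defined by its Mellin–Barnes integral), $K_1=\frac{1}{\alpha e^{L\mu\kappa}}C_iV(k,p,L\mu-1)(L\mu\kappa)^k$, $K_2=\frac{BD^\alpha}{\varrho L\bar\gamma}$, $\Psi_i=\frac{\beta_i+1}{\alpha}$, $\zeta=\frac{\rho_{\mathcal D}}{r_{\mathcal D}}+\frac{\rho_{\tilde{\mathcal E}}}{r_{\tilde{\mathcal E}}}$; for the eavesdropper $\Upsilon_1=\frac{(\mathbb EY_{\tilde{\mathcal E}})^{\rho_{\tilde{\mathcal E}}}}{r_{\tilde{\mathcal E}}\Gamma(\rho_{\tilde{\mathcal E}})w_{\tilde{\mathcal E}}^{\rho_{\tilde{\mathcal E}}}\tau_{\tilde{\mathcal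 E}}^{\rho_{\tilde{\mathcal E}}/r_{\tilde{\mathcal E}}}}$ and $\Upsilon_2=\frac{\mathbb EY_{\tilde{\mathcal E}}}{w_{\tilde{\mathcal E}}\tau_{\tilde{\mathcal E}}^{1/r_{\tilde{\mathcal E}}}}$; for the destination $\Upsilon_3'=\phi^{\rho_{\mathcal D}/r_{\mathcal D}}\,\frac{(\mathbb EY_{\mathcal D})^{\rho_{\mathcal D}}}{\sqrt{r_{\mathcal D}}\,\Gamma(\rho_{\mathcal D})w_{\mathcal D}^{\rho_{\mathcal D}}\tau_{\mathcal D}^{\rho_{\mathcal D}/r_{\mathcal D}}(2\pi)^{(r_{\mathcal D}-1)/2}}$ and $\Upsilon_4'=\phi\,\frac{(\mathbb EY_{\mathcal D})^{r_{\mathcal D}}}{r_{\mathcal D}^{r_{\mathcal D}}w_{\mathcal D}^{r_{\mathcal D}}\tau_{\mathcal D}}$; and $\Omega_{18}=\frac{\Upsilon_2^{r_{\tilde{\mathcal E}}}r_{\tilde{\mathcal E}}^{-r_{\tilde{\mathcal E}}}}{\Upsilon_4'}$. The upper parameters are $S=\bigl(1-\zeta,\,1-\frac{\rho_{\tilde{\mathcal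 E}}}{r_{\tilde{\mathcal E}}}\bigr)$ if $r_{\mathcal D}=1$ and $S=\bigl(1-\zeta,\,\frac12-\zeta,\,1-\frac{\rho_{\tilde{\mathcal E}}}{r_{\tilde{\mathcal E}}}\bigr)$ if $r_{\mathcal D}=2$; the lower parameters are $S'=\bigl(0,\,-\frac{\rho_{\tilde{\mathcal E}}}{r_{\tilde{\mathcal E}}}\bigr)$ if $r_{\tilde{\mathcal E}}=1$ and $S'=\bigl(0,\,\frac12,\,-\frac{\rho_{\tilde{\mathcal E}}}{r_{\tilde{\mathcal E}}}\bigr)$ if $r_{\tilde{\mathcal E}}=2$. -/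

import Mathlib

open MeasureTheory ProbabilityTheory

noncomputable section

namespace RFUOWC

/-! ### The Meijer G-function -/

/-- The Mellin–Barnes integrand of `G^{m,n}_{p,q}[z | a; b]`, where `a = (a₁, …, a_p)` and
`b = (b₁, …, b_q)` are lists:
`∏_{j ≤ m} Γ(b_j - s) ∏_{j ≤ n} Γ(1 - a_j + s) /
  (∏_{j > m} Γ(1 - b_j + s) ∏_{j > n} Γ(a_j - s)) * z ^ s`. -/
def meijerIntegrand (m n : ℕ) (a b : List ℝ) (z : ℝ) (s : ℂ) : ℂ :=
  ((b.take m).map fun x : ℝ => Complex.Gamma (x - s)).prod *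
    ((a.take n).map fun x : ℝ => Complex.Gamma (1 - x + s)).prod /
    (((b.drop m).map fun x : ℝ => Complex.Gamma (1 - x + s)).prod *
      ((a.drop n).map fun x : ℝ => Complex.Gamma (x - s)).prod) *
    (z : ℂ) ^ s

/-- The vertical line `Re s = σ` separates the poles of the `Γ(b_j - s)`, `j ≤ m`, (on its right)
from those of the `Γ(1 - a_j + s)`, `j ≤ n`, (on its left). -/
def IsMeijerLine (m n : ℕ) (a b : List ℝ) (σ : ℝ) : Prop :=
  (∀ x ∈ a.take n, x - 1 < σ) ∧ ∀ x ∈ b.take m, σ < x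

open Classical in
/-- The Meijer G-function `G^{m,n}_{p,q}[z | a; b]` with real parameters and `z > 0`, given by
`(1 / 2πi) ∫ meijerIntegrand ds` along a vertical line that separates the two families of poles
(by Cauchy's theorem the choice of the line does not matter).
The value is `0` if there is no such line. -/
def meijerG (m n : ℕ) (a b : List ℝ) (z : ℝ) : ℂ :=
  if h : ∃ σ : ℝ, IsMeijerLine m n a b σ then
    1 / (2 * (Real.pi : ℂ)) *
      ∫ t : ℝ, meijerIntegrand m n a b z ((h.choose : ℂ) + (t : ℂ) * Complex.I)
  else 0

/-! ### The radio-frequency hop -/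

/-- Parameters of the link from the UAV to the relay: κ-μ fading, `L` maximum-ratio-combining
antennas, path-loss exponent `α`, cell radius `D`, antenna gain factor `ϱ`, average SNR `γbar` of
a branch, and the order `p` of the approximation of the Bessel function in the fading density. -/
structure RFLink where
  κ : ℝ
  μ : ℝ
  L : ℕ
  α : ℝ
  D : ℝ
  ϱ : ℝ
  γbar : ℝ
  p : ℕ
  κ_pos : 0 < κ
  μ_pos : 0 < μ
  L_pos : 1 ≤ L
  α_pos : 0 < α
  D_pos : 0 < D
  ϱ_pos : 0 < ϱ
  γbar_pos : 0 < γbar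
  p_pos : 1 ≤ p

/-- Weights of the three-dimensional random waypoint density. -/
def rwpC : Fin 3 → ℝ := ![735 / 72, -1190 / 72, 455 / 72]

/-- Exponents of the three-dimensional random waypoint density. -/
def rwpβ : Fin 3 → ℝ := ![2, 4, 6]

/-- The coefficients `V(k, p, v)` of the order-`p` approximation of the Bessel function `I_v`. -/
def besselV (k p : ℕ) (v : ℝ) : ℝ :=
  Real.Gamma ((p : ℝ) + k) * (p : ℝ) ^ (1 - 2 * (k : ℤ)) /
    (Real.Gamma ((k : ℝ) + 1) * Real.Gamma ((p : ℝ) - k + 1) * Real.Gamma (v + k + 1))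

/-- The order-`p` approximation of the modified Bessel function of the first kind `I_v(x)`. -/
def besselApprox (p : ℕ) (v x : ℝ) : ℝ :=
  ∑ k ∈ Finset.range (p + 1), besselV k p v * (x / 2) ^ (v + 2 * (k : ℝ))

namespace RFLink

variable (R : RFLink)

/-- Density of the distance between the source and the relay (random waypoint model). -/
def distancePDF (q : ℝ) : ℝ :=
  ∑ i, rwpC i / R.D ^ (rwpβ i + 1) * q ^ rwpβ i

/-- Law of the distance between the source and the relay. -/
def distanceLaw : Measure ℝ :=
  (volume.restrict (Set.Ioc 0 R.D)).withDensity fun q => ENNReal.ofReal (R.distancePDF q)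

/-- The parameter `μ` of the combiner output: combining `L` κ-μ branches gives κ-μ fading with
parameters `κ`, `L μ` and average SNR `L γbar`. -/
def μMRC : ℝ := R.L * R.μ

/-- The constant `A` of the κ-μ density at the combiner output. -/
def A : ℝ :=
  2 * R.μMRC * (1 + R.κ) ^ ((R.μMRC + 1) / 2) /
    (R.κ ^ ((R.μMRC - 1) / 2) * Real.exp (R.μMRC * R.κ))

/-- The constant `B` of the κ-μ density at the combiner output. -/
def B : ℝ := R.μMRC * (1 + R.κ)

/-- The constant `M` of the κ-μ density at the combiner output. -/
def M : ℝ := 2 * R.μMRC * √(R.κ * (1 + R.κ))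

/-- Density of the normalised fading power `W = |h|²` at the combiner output, with the Bessel
function replaced by its order-`p` approximation. -/
def fadingPowerPDF (w : ℝ) : ℝ :=
  R.A / 2 * √w ^ (R.μMRC - 1) * Real.exp (-R.B * w) *
    besselApprox R.p (R.μMRC - 1) (R.M * √w)

/-- Law of the normalised fading power at the combiner output. -/
def fadingPowerLaw : Measure ℝ :=
  (volume.restrict (Set.Ioi 0)).withDensity fun w => ENNReal.ofReal (R.fadingPowerPDF w)

/-- Law of the SNR `γ_R = ϱ q^(-α) (L γbar) W`, with `q` and `W` independent. -/
def snrLaw : Measure ℝ :=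
  (R.distanceLaw.prod R.fadingPowerLaw).map fun x =>
    R.ϱ * x.1 ^ (-R.α) * (R.L * R.γbar) * x.2

/-- The CDF `F_{γ_R}`. -/
def snrCDF (x : ℝ) : ℝ := R.snrLaw.real (Set.Iic x)

/-- `Ψ_i = (β_i + 1) / α`. -/
def Ψ (i : Fin 3) : ℝ := 1 / R.α * (rwpβ i + 1)

/-- `K₁`, for the indices `i` and `k`. -/
def K₁ (i : Fin 3) (k : ℕ) : ℝ :=
  1 / (R.α * Real.exp (R.L * R.μ * R.κ)) * rwpC i * besselV k R.p (R.L * R.μ - 1) *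
    (R.L * R.μ * R.κ) ^ k

/-- `K₂`. -/
def K₂ : ℝ := R.B * R.D ^ R.α / (R.ϱ * R.L * R.γbar)

/-- The closed form
`∑_i ∑_{k ≤ p} K₁ G^{1,2}_{2,3}[K₂ x | 1 - Ψ_i, 1; L μ + k, 0, -Ψ_i]` of the CDF of `γ_R`. -/
def cdfClosedForm (x : ℝ) : ℂ :=
  ∑ i : Fin 3, ∑ k ∈ Finset.range (R.p + 1),
    (R.K₁ i k : ℂ) *
      meijerG 1 2 [1 - R.Ψ i, 1] [R.L * R.μ + k, 0, -R.Ψ i] (R.K₂ * x)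

end RFLink

/-! ### The underwater optical hop -/

/-- An underwater optical channel: mixture exponential–generalised gamma (mEGG) turbulence with
mixture weight `ω`, exponential parameter `ν` and generalised gamma parameters `a`, `b`, `c`,
and pointing error with parameters `ξ` (pointing error) and `J` (pointing loss). -/
structure OpticalChannel where
  ω : ℝ
  ν : ℝ
  a : ℝ
  b : ℝ
  c : ℝ
  ξ : ℝ
  J : ℝ
  ω_pos : 0 < ω
  ω_lt_one : ω < 1
  ν_pos : 0 < ν
  a_pos : 0 < a
  b_pos : 0 < b
  c_pos : 0 < c
  ξ_pos : 0 < ξ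
  J_pos : 0 < J

namespace OpticalChannel

variable (C : OpticalChannel)

/-- The mEGG density of the turbulence-induced gain. -/
def turbulencePDF (x : ℝ) : ℝ :=
  C.ω / C.ν * Real.exp (-(x / C.ν)) +
    (1 - C.ω) * (C.c * x ^ (C.a * C.c - 1) / (C.b ^ (C.a * C.c) * Real.Gamma C.a) *
      Real.exp (-(x / C.b) ^ C.c))

/-- The density of the gain due to pointing error. -/
def pointingPDF (x : ℝ) : ℝ := C.ξ ^ 2 / C.J ^ (C.ξ ^ 2) * x ^ (C.ξ ^ 2 - 1)

/-- The law of the turbulence-induced gain. -/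
def turbulenceLaw : Measure ℝ :=
  (volume.restrict (Set.Ioi 0)).withDensity fun x => ENNReal.ofReal (C.turbulencePDF x)

/-- The law of the gain due to pointing error. -/
def pointingLaw : Measure ℝ :=
  (volume.restrict (Set.Ioc 0 C.J)).withDensity fun x => ENNReal.ofReal (C.pointingPDF x)

/-- The law of the channel gain, the product of the two independent gains. -/
def gainLaw : Measure ℝ := C.turbulenceLaw.mconv C.pointingLaw

end OpticalChannel

/-- The path from the relay through the RIS to a receiver (the destination or the eavesdropper):
`first` is the channel from the relay to an RIS element, `second` the channel from an RIS element
to the receiver, `N` the number of RIS elements, `r` the detection method (`r = 1` heterodyne,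
`r = 2` intensity modulation / direct detection), `η` the conversion coefficient and `N₀` the noise
power. -/
structure RISLink where
  first : OpticalChannel
  second : OpticalChannel
  N : ℕ
  r : ℕ
  η : ℝ
  N₀ : ℝ
  N_pos : 1 ≤ N
  r_mem : r = 1 ∨ r = 2
  η_pos : 0 < η
  N₀_pos : 0 < N₀

namespace RISLink

variable (n : RISLink)

/-- The law of the cascaded gain `Y = α β` of one RIS element. -/
def cascadeLaw : Measure ℝ := n.first.gainLaw.mconv n.second.gainLaw

/-- `E(Y)`. -/
def meanY : ℝ := ∫ y, y ∂n.cascadeLaw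

/-- `Var(Y)`. -/
def varY : ℝ := Var[fun y => y; n.cascadeLaw]

/-- The shape `ρ = E(χ)² / Var(χ)` of the gamma approximation of `χ = ∑_{u ≤ N} Y_u`. -/
def ρ : ℝ := (n.N * n.meanY) ^ 2 / (n.N * n.varY)

/-- The scale `w = Var(χ) / E(χ)` of the gamma approximation of `χ`. -/
def w : ℝ := n.N * n.varY / (n.N * n.meanY)

/-- The electrical SNR `τ = (η E(Y))^r / N₀`. -/
def τ : ℝ := (n.η * n.meanY) ^ n.r / n.N₀

/-- The law of the SNR `γ = τ (χ / E(Y))^r`, where `χ` is gamma distributed with shape `ρ` and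
scale `w` (that is, rate `1 / w`). Its density is
`Υ₁ γ^(ρ/r - 1) exp(-Υ₂ γ^(1/r))`. -/
def snrLaw : Measure ℝ :=
  (gammaMeasure n.ρ (1 / n.w)).map fun χ => n.τ * (χ / n.meanY) ^ n.r

/-- The CDF of the SNR. -/
def snrCDF (x : ℝ) : ℝ := n.snrLaw.real (Set.Iic x)

def Υ₁ : ℝ :=
  n.meanY ^ n.ρ / (n.r * Real.Gamma n.ρ * n.w ^ n.ρ * n.τ ^ (n.ρ / n.r))

def Υ₂ : ℝ := n.meanY / (n.w * n.τ ^ (1 / (n.r : ℝ)))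

def Υ₃ : ℝ :=
  n.meanY ^ n.ρ / (√n.r * Real.Gamma n.ρ * n.w ^ n.ρ * n.τ ^ (n.ρ / n.r) *
    (2 * Real.pi) ^ (((n.r : ℝ) - 1) / 2))

def Υ₄ : ℝ := n.meanY ^ n.r / ((n.r : ℝ) ^ n.r * n.w ^ n.r * n.τ)

end RISLink

/-! ### Secrecy outage probability when the eavesdropper attacks the optical hop -/

/-- `φ = 2 ^ R_s`, for the target secrecy rate `R_s`. -/
def φ (Rs : ℝ) : ℝ := 2 ^ Rs

/-- The secrecy outage probability
`∫ F_{γ_D}(φ γ + φ - 1) dF_{γ_E}(γ) (1 - F_{γ_R}(φ - 1)) + F_{γ_R}(φ - 1)`. -/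
def sop (R : RFLink) (D E : RISLink) (Rs : ℝ) : ℝ :=
  (∫ γ, D.snrCDF (φ Rs * γ + φ Rs - 1) ∂E.snrLaw) * (1 - R.snrCDF (φ Rs - 1)) +
    R.snrCDF (φ Rs - 1)

/-- The lower bound
`∫ F_{γ_D}(φ γ) dF_{γ_E}(γ) (1 - F_{γ_R}(φ - 1)) + F_{γ_R}(φ - 1)` of the secrecy outage
probability. -/
def sopLower (R : RFLink) (D E : RISLink) (Rs : ℝ) : ℝ :=
  (∫ γ, D.snrCDF (φ Rs * γ) ∂E.snrLaw) * (1 - R.snrCDF (φ Rs - 1)) + R.snrCDF (φ Rs - 1)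

/-- `ζ = ρ_D / r_D + ρ_E / r_E`. -/
def ζ (D E : RISLink) : ℝ := D.ρ / D.r + E.ρ / E.r

/-- `Υ₃' = φ^(ρ_D / r_D) Υ₃` of the destination. -/
def Υ₃' (D : RISLink) (Rs : ℝ) : ℝ := φ Rs ^ (D.ρ / D.r) * D.Υ₃

/-- `Υ₄' = φ Υ₄` of the destination. -/
def Υ₄' (D : RISLink) (Rs : ℝ) : ℝ := φ Rs * D.Υ₄

/-- `Ω₁₈ = Υ₂^{r_E} r_E^{-r_E} / Υ₄'`. -/
def Ω₁₈ (D E : RISLink) (Rs : ℝ) : ℝ :=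
  E.Υ₂ ^ E.r * ((E.r : ℝ) ^ E.r)⁻¹ / Υ₄' D Rs

/-- The `r_D + 1` upper parameters: `1 - ζ, 1 - ρ_E/r_E` if `r_D = 1`, and
`1 - ζ, 1 - ζ - 1/2, 1 - ρ_E/r_E` if `r_D = 2`. -/
def upperParams (D E : RISLink) : List ℝ :=
  (List.range D.r).map (fun k : ℕ => 1 - ζ D E - (k : ℝ) / D.r) ++ [1 - E.ρ / E.r]

/-- The `r_E + 1` lower parameters: `0, -ρ_E/r_E` if `r_E = 1`, and `0, 1/2, -ρ_E/r_E` if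
`r_E = 2`. -/
def lowerParams (E : RISLink) : List ℝ :=
  (List.range E.r).map (fun k : ℕ => (k : ℝ) / E.r) ++ [-(E.ρ / E.r)]

/-- The term of the closed form that stems from the optical hop,
`Υ₃' Υ₁ r_E^{1/2} (Υ₄')^{-ζ} / (2π)^{(r_E - 1)/2} G^{r_E+1, r_D}_{r_D+1, r_E+1}[Ω₁₈ | …]`. -/
def opticalClosedForm (D E : RISLink) (Rs : ℝ) : ℂ :=
  ((Υ₃' D Rs * E.Υ₁ * ((E.r : ℝ) ^ (1 / 2 : ℝ) * Υ₄' D Rs ^ (-ζ D E) /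
      (2 * Real.pi) ^ (1 / 2 * ((E.r : ℝ) - 1))) : ℝ) : ℂ) *
    meijerG (E.r + 1) D.r (upperParams D E) (lowerParams E) (Ω₁₈ D E Rs)

end RFUOWC

end

/-! Both closed forms rest on one device. The function equal to (1 - y^(-Ψ))/Ψ for y ≥ 1 and to 0
for y < 1 (`perronKernel`) is the inverse Mellin transform of 1/(s(s+Ψ)). Unlike the transform 1/s
of a plain jump, this is absolutely integrable on vertical lines, so `perron_integral` may average
the inversion formula over a weight by Fubini; gamma weights then contribute gamma functions of s.

RF hop. The tail of the distance law is a combination of kernels with Ψ = Ψ_i (`distanceLaw_Ici`),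
and the truncated fading density is a finite sum of multiples of gamma densities of shapes Lμ + k
(`fadingPowerPDF_eq`). In each Meijer function two gamma quotients collapse to 1/(s(s+Ψ_i)), leaving
Γ(Lμ+k-s), the moment of the gamma weight (`rf_integrand`, `rf_meijerG`).

Optical hop. The integral is P(γ_D ≤ φ γ_E), that is P(V^(r_D) ≤ y U^(r_E)) for independent gamma
variables V and U (`integral_snrCDF`). Integration by parts in U produces the kernel
(`gammaMeasure_real_tail`), whence a Mellin–Barnes integral of Γ(ρ_E + r_E s) Γ(ρ_D - r_D s)/s
(`gamma_comparison`). The reflection s ↦ -ρ_E/r_E - s and the duplication formula turn it into the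
stated Meijer integrand (`optical_integrand`). Both computations hold on every separating line, so
the choice made in `meijerG` is harmless and no contour is ever shifted.

For the gamma model to make sense, E Y and Var Y must be positive. This follows from properties
stable under independent products: positivity, a second moment and absence of atoms (`IsGain`).

The inequality is monotonicity of the destination CDF together with 1 - F_R ≥ 0. The latter needs
proof, because the approximate fading density need not have mass 1; `fadingPowerLaw_univ_le` bounds
its mass by 1. -/

namespace RFUOWC

/-! ### A truncated Perron formula -/

/-- The inverse Mellin transform of `1 / (s (s + Ψ))` at `y`. -/
noncomputable def perronKernel (Ψ y : ℝ) : ℝ := if 1 ≤ y then (1 - y ^ (-Ψ)) / Ψ else 0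

lemma measurable_perronKernel (Ψ : ℝ) : Measurable (perronKernel Ψ) :=
  Measurable.ite measurableSet_Ici (by fun_prop) measurable_const

lemma perronKernel_nonneg {Ψ : ℝ} (hΨ : 0 < Ψ) (y : ℝ) : 0 ≤ perronKernel Ψ y := by
  unfold perronKernel
  split_ifs with h
  · have : y ^ (-Ψ) ≤ 1 := Real.rpow_le_one_of_one_le_of_nonpos h (by linarith)
    exact div_nonneg (by linarith) hΨ.le
  · exact le_rfl

lemma perronKernel_le {Ψ : ℝ} (hΨ : 0 < Ψ) (y : ℝ) : perronKernel Ψ y ≤ 1 / Ψ := by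
  unfold perronKernel
  split_ifs with h
  · have : 0 ≤ y ^ (-Ψ) := Real.rpow_nonneg (by linarith) _
    gcongr
    linarith
  · positivity

lemma line_ne_zero {σ : ℝ} (hσ : 0 < σ) (t : ℝ) : (σ : ℂ) + t * Complex.I ≠ 0 := by
  intro h
  have := congrArg Complex.re h
  simp at this
  exact hσ.ne' this

lemma integrable_inv_quadratic_line {Ψ σ : ℝ} (hΨ : 0 < Ψ) (hσ : 0 < σ) :
    Integrable fun t : ℝ =>
      (((σ : ℂ) + t * Complex.I) * ((σ : ℂ) + t * Complex.I + Ψ))⁻¹ := by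
  have h1 : Integrable fun t : ℝ => (σ ^ 2)⁻¹ * (1 + (t / σ) ^ 2)⁻¹ :=
    ((integrable_inv_one_add_sq).comp_div hσ.ne').const_mul _
  have hne : ∀ t : ℝ, ((σ : ℂ) + t * Complex.I) * ((σ : ℂ) + t * Complex.I + Ψ) ≠ 0 := by
    intro t
    refine mul_ne_zero (line_ne_zero hσ t) ?_
    have := line_ne_zero (add_pos hσ hΨ) t
    push_cast at this
    intro h
    exact this (by rw [← h]; ring)
  refine h1.mono' ?_ (Filter.Eventually.of_forall fun t => ?_)
  · exact (Continuous.inv₀ (by fun_prop) hne).aestronglyMeasurable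
  · have e : (σ ^ 2)⁻¹ * (1 + (t / σ) ^ 2)⁻¹ = (σ ^ 2 + t ^ 2)⁻¹ := by
      field_simp
    have n1 : ‖(σ : ℂ) + t * Complex.I‖ = √(σ ^ 2 + t ^ 2) := Complex.norm_add_mul_I σ t
    have n2 : √(σ ^ 2 + t ^ 2) ≤ ‖(σ : ℂ) + t * Complex.I + Ψ‖ := by
      have : (σ : ℂ) + t * Complex.I + Ψ = ((σ + Ψ : ℝ) : ℂ) + t * Complex.I := by
        push_cast; ring
      rw [this, Complex.norm_add_mul_I]
      gcongr
      linarith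
    rw [e, norm_inv, norm_mul, n1]
    have hp : 0 < σ ^ 2 + t ^ 2 := by positivity
    apply inv_anti₀ hp
    calc σ ^ 2 + t ^ 2 = √(σ ^ 2 + t ^ 2) * √(σ ^ 2 + t ^ 2) := (Real.mul_self_sqrt hp.le).symm
      _ ≤ _ := by gcongr

/-- Mellin inversion at 1/y of (1 - t^Ψ)/Ψ on (0,1], whose transform is (1/s - 1/(s+Ψ))/Ψ. Inverting
at 1/y rather than y turns x^(-s) into y^s. -/
lemma perron {Ψ σ y : ℝ} (hΨ : 0 < Ψ) (hσ : 0 < σ) (hy : 0 < y) :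
    (1 / (2 * (Real.pi : ℂ))) * ∫ t : ℝ,
      (((σ : ℂ) + t * Complex.I) * ((σ : ℂ) + t * Complex.I + Ψ))⁻¹ *
        (y : ℂ) ^ ((σ : ℂ) + t * Complex.I) = perronKernel Ψ y := by
  set f : ℝ → ℂ := fun t => ((Set.Ioc (0 : ℝ) 1).indicator (fun _ => (1 : ℂ)) t -
    (Set.Ioc (0 : ℝ) 1).indicator (fun t : ℝ => (t : ℂ) ^ (Ψ : ℂ)) t) / Ψ with hf
  have hΨc : (Ψ : ℂ) ≠ 0 := by exact_mod_cast hΨ.ne'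
  have hM : ∀ s : ℂ, 0 < s.re → HasMellin f s ((s * (s + Ψ))⁻¹) := by
    intro s hs
    have h1 := hasMellin_one_Ioc hs
    have h2 := hasMellin_cpow_Ioc (Ψ : ℂ) (s := s) (by simpa using add_pos hs hΨ)
    have h3 := hasMellin_sub h1.1 h2.1
    have hs0 : s ≠ 0 := by rintro rfl; simp at hs
    have hs1 : s + Ψ ≠ 0 := by
      intro h
      have := congrArg Complex.re h
      simp at this
      linarith
    refine ⟨h3.1.div_const _, ?_⟩
    rw [hf, mellin_div_const, h3.2, h1.2, h2.2]
    field_simp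
    ring
  have key := mellinInv_mellin_eq σ f (x := y⁻¹) (inv_pos.2 hy) (hM _ (by simpa using hσ)).1 ?_ ?_
  · rw [mellinInv] at key
    have hfy : f y⁻¹ = perronKernel Ψ y := by
      simp only [hf, perronKernel, Set.indicator_apply, Set.mem_Ioc, inv_pos, hy, true_and,
        inv_le_one₀ hy]
      split_ifs with h
      · rw [Real.rpow_neg hy.le, ← Real.inv_rpow hy.le]
        push_cast [Complex.ofReal_cpow (inv_pos.2 hy).le]
        rfl
      · simp
    rw [← hfy, ← key, Complex.real_smul]
    push_cast
    congr 1
    refine integral_congr_ae (Filter.Eventually.of_forall fun t => ?_)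
    simp only [smul_eq_mul]
    rw [(hM _ (by simpa using hσ)).2, mul_comm, Complex.inv_cpow, Complex.cpow_neg, inv_inv]
    rw [Complex.arg_ofReal_of_nonneg hy.le]
    exact Real.pi_pos.ne
  · refine (integrable_inv_quadratic_line hΨ hσ).congr (Filter.Eventually.of_forall fun t => ?_)
    exact ((hM _ (by simpa using hσ)).2).symm
  · have hc : ContinuousAt (fun t : ℝ => (((1 - (min 1 t) ^ Ψ) / Ψ : ℝ) : ℂ)) y⁻¹ := by
      apply Continuous.continuousAt
      refine Complex.continuous_ofReal.comp (Continuous.div_const (continuous_const.sub ?_) _)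
      exact Continuous.rpow_const (by fun_prop) (fun _ => Or.inr hΨ.le)
    refine hc.congr ?_
    filter_upwards [lt_mem_nhds (inv_pos.2 hy)] with t ht
    simp only [hf, Set.indicator_apply, Set.mem_Ioc, ht, true_and]
    split_ifs with h
    · rw [min_eq_right h]
      push_cast [Complex.ofReal_cpow ht.le]
      rfl
    · rw [min_eq_left (not_le.1 h).le]
      simp

/-- Perron's formula integrated against a weight. -/
lemma perron_integral {Ω : Type*} [MeasurableSpace Ω] (ν : Measure Ω) [SFinite ν]
    {Ψ σ : ℝ} (hΨ : 0 < Ψ) (hσ : 0 < σ) {wt Y : Ω → ℝ} (hwt : Measurable wt) (hY : Measurable Y)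
    (hpos : ∀ᵐ ω ∂ν, 0 < Y ω) (hint : Integrable (fun ω => wt ω * Y ω ^ σ) ν) :
    (1 / (2 * (Real.pi : ℂ))) * ∫ t : ℝ,
      (((σ : ℂ) + t * Complex.I) * ((σ : ℂ) + t * Complex.I + Ψ))⁻¹ *
        ∫ ω, (wt ω : ℂ) * (Y ω : ℂ) ^ ((σ : ℂ) + t * Complex.I) ∂ν =
      ((∫ ω, wt ω * perronKernel Ψ (Y ω) ∂ν : ℝ) : ℂ) := by
  have hsw : Integrable (Function.uncurry fun (t : ℝ) (ω : Ω) =>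
      (((σ : ℂ) + t * Complex.I) * ((σ : ℂ) + t * Complex.I + Ψ))⁻¹ *
        ((wt ω : ℂ) * (Y ω : ℂ) ^ ((σ : ℂ) + t * Complex.I))) (volume.prod ν) := by
    -- On the line |Y^s| = Y^σ does not depend on t, so the norm of the integrand splits as a
    -- product of two integrable functions.
    have h0 := (integrable_inv_quadratic_line hΨ hσ).norm.mul_prod hint.norm
    refine h0.mono' ?_ ?_
    · refine Measurable.aestronglyMeasurable ?_
      simp only [Function.uncurry_def]
      fun_prop
    · have : ∀ᵐ z ∂((volume : Measure ℝ).prod ν), 0 < Y z.2 :=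
        Measure.quasiMeasurePreserving_snd.ae hpos
      filter_upwards [this] with z hz
      simp only [Function.uncurry_def]
      rw [norm_mul, norm_mul, norm_mul, Complex.norm_cpow_eq_rpow_re_of_pos hz,
        Complex.norm_real, Real.norm_of_nonneg (Real.rpow_nonneg hz.le σ)]
      simp
  simp only [← integral_const_mul (μ := ν)]
  rw [integral_integral_swap hsw, ← integral_const_mul, ← integral_complex_ofReal]
  refine integral_congr_ae ?_
  filter_upwards [hpos] with ω hω
  rw [Complex.ofReal_mul, ← perron hΨ hσ hω, ← integral_const_mul, ← integral_const_mul,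
    ← integral_const_mul]
  refine integral_congr_ae (Filter.Eventually.of_forall fun t => ?_)
  simp only
  ring

/-! ### Mean and variance of the cascaded optical gain -/

/-- A nonzero finite law of a positive random variable that has a second moment and no atoms. -/
structure IsGain (ν : Measure ℝ) : Prop where
  finite : IsFiniteMeasure ν
  ne_zero : ν ≠ 0
  sq : Integrable (fun x => x ^ 2) ν
  pos : ∀ᵐ x ∂ν, 0 < x
  no_atom : ∀ c, ν {c} = 0

namespace IsGain

lemma withDensity {s : Set ℝ} {f : ℝ → ℝ} (hs : MeasurableSet s) (hs0 : s ⊆ Set.Ioi 0)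
    (hs1 : volume s ≠ 0) (hf : Measurable f) (hpos : ∀ x ∈ s, 0 < f x) (hint : IntegrableOn f s)
    (hint2 : IntegrableOn (fun x => f x * x ^ 2) s) :
    IsGain ((volume.restrict s).withDensity fun x => ENNReal.ofReal (f x)) := by
  have hfm : Measurable fun x => ENNReal.ofReal (f x) := hf.ennreal_ofReal
  have hac := withDensity_absolutelyContinuous (volume.restrict s) fun x => ENNReal.ofReal (f x)
  refine ⟨⟨?_⟩, ?_, ?_, ?_, ?_⟩
  · rw [withDensity_apply _ MeasurableSet.univ, Measure.restrict_univ]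
    exact hint.lintegral_lt_top
  · intro h
    rw [withDensity_eq_zero_iff hfm.aemeasurable, Filter.EventuallyEq,
      ae_restrict_iff' hs] at h
    apply hs1
    refine measure_mono_null ?_ h
    intro x hx h'
    have := h' hx
    simp only [Pi.zero_apply, ENNReal.ofReal_eq_zero] at this
    exact absurd this (not_le.2 (hpos x hx))
  · rw [integrable_withDensity_iff hfm (Filter.Eventually.of_forall fun _ => ENNReal.ofReal_lt_top)]
    refine (integrable_congr ?_).1 hint2
    filter_upwards [ae_restrict_mem hs] with x hx
    rw [ENNReal.toReal_ofReal (hpos x hx).le, mul_comm]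
  · refine hac.ae_le ?_
    filter_upwards [ae_restrict_mem hs] with x hx
    exact hs0 hx
  · intro c
    exact hac (measure_singleton c)

/-- Second moments multiply. There is no atom at c because, for fixed x > 0, the slice of {xy = c}
is the single point c/x, which is null for `ν`. -/
lemma mconv {μ ν : Measure ℝ} (hμ : IsGain μ) (hν : IsGain ν) : IsGain (μ.mconv ν) := by
  have := hμ.finite
  have := hν.finite
  refine ⟨inferInstance, ?_, ?_, ?_, ?_⟩
  · intro h
    have h1 : (μ.mconv ν) Set.univ = 0 := by rw [h]; rfl
    rw [Measure.mconv, Measure.map_apply measurable_mul MeasurableSet.univ, Set.preimage_univ,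
      Measure.measure_prod_null MeasurableSet.univ] at h1
    have h2 : ∀ᵐ x ∂μ, False := by
      filter_upwards [h1] with x hx
      simp only [Set.preimage_univ, Pi.zero_apply, Measure.measure_univ_eq_zero] at hx
      exact hν.ne_zero hx
    rw [Filter.eventually_false_iff_eq_bot, ae_eq_bot] at h2
    exact hμ.ne_zero h2
  · rw [Measure.mconv, integrable_map_measure (by fun_prop) (by fun_prop)]
    refine (hμ.sq.mul_prod hν.sq).congr (Filter.Eventually.of_forall fun z => ?_)
    simp [mul_pow]
  · rw [Measure.mconv, ae_map_iff (by fun_prop) measurableSet_Ioi]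
    filter_upwards [Measure.quasiMeasurePreserving_fst.ae hμ.pos,
      Measure.quasiMeasurePreserving_snd.ae hν.pos] with z h1 h2
    exact mul_pos h1 h2
  · intro c
    rw [Measure.mconv, Measure.map_apply measurable_mul (measurableSet_singleton c),
      Measure.measure_prod_null (measurable_mul (measurableSet_singleton c))]
    filter_upwards [hμ.pos] with x hx
    refine measure_mono_null ?_ (hν.no_atom (c / x))
    intro y hy
    simp only [Set.mem_preimage, Set.mem_singleton_iff] at hy ⊢
    rw [← hy, mul_div_cancel_left₀ _ hx.ne']

lemma memLp_two {ν : Measure ℝ} (h : IsGain ν) : MemLp (fun x => x) 2 ν :=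
  (memLp_two_iff_integrable_sq (by fun_prop)).2 h.sq

lemma mean_pos {ν : Measure ℝ} (h : IsGain ν) : 0 < ∫ x, x ∂ν := by
  have := h.finite
  have hi : Integrable (fun x => x) ν := h.memLp_two.integrable (by norm_num)
  rw [integral_pos_iff_support_of_nonneg_ae (h.pos.mono fun x hx => hx.le) hi]
  have h1 : (Function.support fun x : ℝ => x) =ᵐ[ν] Set.univ := by
    filter_upwards [h.pos] with x hx
    exact propext ⟨fun _ => trivial, fun _ => hx.ne'⟩
  rw [measure_congr h1]
  exact Measure.measure_univ_pos.2 h.ne_zero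

/-- Zero variance would concentrate the nonzero measure on one point, which would then be an atom.
Total mass one is not needed. -/
lemma variance_pos {ν : Measure ℝ} (h : IsGain ν) : 0 < Var[fun x => x; ν] := by
  have := h.finite
  refine lt_of_le_of_ne (variance_nonneg _ _) fun h0 => ?_
  have h1 := ae_eq_integral_of_variance_eq_zero h.memLp_two h0.symm
  have h2 : ∀ᵐ x ∂ν, x ≠ ∫ x, x ∂ν := by
    rw [ae_iff]
    simpa using h.no_atom (∫ x, x ∂ν)
  have h3 : ∀ᵐ x ∂ν, False := by
    filter_upwards [h1, h2] with x hx hx'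
    exact hx' hx
  rw [Filter.eventually_false_iff_eq_bot, ae_eq_bot] at h3
  exact h.ne_zero h3

end IsGain

lemma OpticalChannel.isGain_pointingLaw (C : OpticalChannel) : IsGain C.pointingLaw := by
  have hξ := C.ξ_pos
  have hJ := C.J_pos
  have hi : ∀ r : ℝ, -1 < r → IntegrableOn (fun x : ℝ => x ^ r) (Set.Ioc 0 C.J) := fun r hr =>
    (intervalIntegrable_iff_integrableOn_Ioc_of_le hJ.le).1
      (intervalIntegral.intervalIntegrable_rpow' hr)
  have hξ2 : 0 < C.ξ ^ 2 := by positivity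
  refine IsGain.withDensity measurableSet_Ioc (fun x hx => hx.1) (by simpa using hJ) ?_ ?_ ?_ ?_
  · unfold pointingPDF; fun_prop
  · intro x hx
    have := hx.1
    unfold pointingPDF
    positivity
  · exact (hi _ (by linarith)).const_mul _
  · refine IntegrableOn.congr_fun ((hi (C.ξ ^ 2 - 1 + 2) (by linarith)).const_mul
      (C.ξ ^ 2 / C.J ^ (C.ξ ^ 2))) ?_ measurableSet_Ioc
    intro x hx
    simp only [pointingPDF]
    rw [Real.rpow_add hx.1]
    norm_num
    ring

lemma OpticalChannel.isGain_turbulenceLaw (C : OpticalChannel) : IsGain C.turbulenceLaw := by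
  have hω := C.ω_pos
  have hω1 := sub_pos.2 C.ω_lt_one
  have hν := C.ν_pos
  have ha := C.a_pos
  have hb := C.b_pos
  have hc := C.c_pos
  have hac := mul_pos ha hc
  have hG := Real.Gamma_pos_of_pos ha
  have h1 : ∀ q : ℝ, -1 < q →
      IntegrableOn (fun x : ℝ => C.ω / C.ν * (x ^ q * Real.exp (-(x / C.ν)))) (Set.Ioi 0) := by
    intro q hq
    refine Integrable.const_mul ?_ _
    refine IntegrableOn.congr_fun (integrableOn_rpow_mul_exp_neg_mul_rpow hq one_pos
      (inv_pos.2 hν)) ?_ measurableSet_Ioi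
    intro x _
    simp only [Real.rpow_one]
    congr 2
    ring
  have h2 : ∀ q : ℝ, -1 < q →
      IntegrableOn (fun x : ℝ => (1 - C.ω) * C.c / (C.b ^ (C.a * C.c) * Real.Gamma C.a) *
        (x ^ q * Real.exp (-(x / C.b) ^ C.c))) (Set.Ioi 0) := by
    intro q hq
    refine Integrable.const_mul ?_ _
    refine IntegrableOn.congr_fun (integrableOn_rpow_mul_exp_neg_mul_rpow (b := (C.b ^ C.c)⁻¹)
      hq hc (by positivity)) ?_ measurableSet_Ioi
    intro x hx
    simp only
    rw [Real.div_rpow (le_of_lt hx) hb.le]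
    congr 2
    ring
  refine IsGain.withDensity measurableSet_Ioi subset_rfl (by simp) ?_ ?_ ?_ ?_
  · unfold turbulencePDF; fun_prop
  · intro x hx
    have : 0 < x := hx
    unfold turbulencePDF
    positivity
  · refine IntegrableOn.congr_fun ((h1 0 (by norm_num)).add (h2 (C.a * C.c - 1) (by linarith)))
      ?_ measurableSet_Ioi
    intro x hx
    simp only [turbulencePDF, Pi.add_apply, Real.rpow_zero]
    ring
  · refine IntegrableOn.congr_fun ((h1 2 (by norm_num)).add (h2 (C.a * C.c - 1 + 2) (by linarith)))
      ?_ measurableSet_Ioi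
    intro x hx
    simp only [turbulencePDF, Pi.add_apply]
    rw [Real.rpow_add hx]
    norm_num
    ring

namespace RISLink

variable (n : RISLink)

lemma isGain_cascadeLaw : IsGain n.cascadeLaw :=
  (n.first.isGain_turbulenceLaw.mconv n.first.isGain_pointingLaw).mconv
    (n.second.isGain_turbulenceLaw.mconv n.second.isGain_pointingLaw)

lemma meanY_pos : 0 < n.meanY := n.isGain_cascadeLaw.mean_pos

lemma varY_pos : 0 < n.varY := n.isGain_cascadeLaw.variance_pos

lemma N_cast_pos : (0 : ℝ) < n.N := by exact_mod_cast n.N_pos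

lemma r_pos : 0 < n.r := by rcases n.r_mem with h | h <;> omega

lemma r_cast_pos : (0 : ℝ) < n.r := by exact_mod_cast n.r_pos

lemma ρ_pos : 0 < n.ρ := by
  have := n.meanY_pos
  have := n.varY_pos
  have := n.N_cast_pos
  unfold ρ
  positivity

lemma w_pos : 0 < n.w := by
  have := n.meanY_pos
  have := n.varY_pos
  have := n.N_cast_pos
  unfold w
  positivity

lemma τ_pos : 0 < n.τ := by
  have := n.meanY_pos
  have := n.η_pos
  have := n.N₀_pos
  unfold τ
  positivity

lemma isProbabilityMeasure_gamma : IsProbabilityMeasure (gammaMeasure n.ρ (1 / n.w)) :=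
  isProbabilityMeasure_gammaMeasure n.ρ_pos (one_div_pos.2 n.w_pos)

lemma measurable_snr : Measurable fun χ : ℝ => n.τ * (χ / n.meanY) ^ n.r := by fun_prop

lemma isProbabilityMeasure_snrLaw : IsProbabilityMeasure n.snrLaw :=
  have := n.isProbabilityMeasure_gamma
  Measure.isProbabilityMeasure_map n.measurable_snr.aemeasurable

lemma monotone_snrCDF : Monotone n.snrCDF := by
  have := n.isProbabilityMeasure_snrLaw
  intro x y h
  exact measureReal_mono (Set.Iic_subset_Iic.2 h)

end RISLink

/-! ### Comparison of powers of gamma variables -/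

lemma integrableOn_rpow_mul_exp_neg {q b : ℝ} (hq : -1 < q) (hb : 0 < b) :
    IntegrableOn (fun x : ℝ => x ^ q * Real.exp (-(b * x))) (Set.Ioi 0) := by
  simpa using integrableOn_rpow_mul_exp_neg_mul_rpow hq one_pos hb

lemma integral_Ioi_exp_neg_mul {b T : ℝ} (hb : 0 < b) :
    ∫ u in Set.Ioi T, b * Real.exp (-(b * u)) = Real.exp (-(b * T)) := by
  have h := integral_exp_mul_Ioi (neg_lt_zero.2 hb) T
  simp only [neg_mul] at h
  rw [integral_const_mul, h]
  field_simp

/-- Integration by parts for the upper incomplete gamma function. -/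
lemma upper_incomplete_gamma {ρ b T : ℝ} (hρ : 0 < ρ) (hb : 0 < b) (hT : 0 < T) :
    ∫ u in Set.Ioi T, ρ * (u ^ (ρ - 1) * Real.exp (-(b * u))) =
      ∫ u in Set.Ioi T, b * ((u ^ ρ - T ^ ρ) * Real.exp (-(b * u))) := by
  have hsub : Set.Ioi T ⊆ Set.Ioi 0 := Set.Ioi_subset_Ioi hT.le
  have i1 : IntegrableOn (fun u : ℝ => u ^ (ρ - 1) * Real.exp (-(b * u))) (Set.Ioi T) :=
    (integrableOn_rpow_mul_exp_neg (by linarith) hb).mono_set hsub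
  have i2 : IntegrableOn (fun u : ℝ => u ^ ρ * Real.exp (-(b * u))) (Set.Ioi T) :=
    (integrableOn_rpow_mul_exp_neg (by linarith) hb).mono_set hsub
  have i3 : IntegrableOn (fun u : ℝ => Real.exp (-(b * u))) (Set.Ioi T) := by
    simpa using (integrableOn_rpow_mul_exp_neg (q := 0) (by norm_num) hb).mono_set hsub
  have hd : ∀ x : ℝ, 0 < x → HasDerivAt (fun u : ℝ => -(u ^ ρ * Real.exp (-(b * u))))
      (b * (x ^ ρ * Real.exp (-(b * x))) - ρ * (x ^ (ρ - 1) * Real.exp (-(b * x)))) x := by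
    intro x hx
    have h1 := Real.hasDerivAt_rpow_const (x := x) (p := ρ) (Or.inl hx.ne')
    have h2 : HasDerivAt (fun u : ℝ => Real.exp (-(b * u))) (Real.exp (-(b * x)) * -(b * 1)) x :=
      (((hasDerivAt_id x).const_mul b).neg).exp
    refine (h1.mul h2).neg.congr_deriv ?_
    ring
  have key := integral_Ioi_of_hasDerivAt_of_tendsto (a := T) (m := 0)
    (hd T hT).continuousAt.continuousWithinAt (fun x hx => hd x (hT.trans hx))
    ((i2.const_mul b).sub (i1.const_mul ρ))
    (by simpa using (tendsto_rpow_mul_exp_neg_mul_atTop_nhds_zero ρ b hb).neg)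
  rw [integral_sub (i2.const_mul b) (i1.const_mul ρ)] at key
  -- The boundary term T^ρ e^(-bT) is itself the integral over (T, ∞) of T^ρ b e^(-bu), so it can be
  -- absorbed into the integrand.
  have e : ∀ u : ℝ, b * ((u ^ ρ - T ^ ρ) * Real.exp (-(b * u))) =
      b * (u ^ ρ * Real.exp (-(b * u))) - T ^ ρ * (b * Real.exp (-(b * u))) := fun u => by ring
  simp_rw [e]
  rw [integral_sub (i2.const_mul b) ((i3.const_mul b).const_mul _),
    integral_const_mul (T ^ ρ), integral_Ioi_exp_neg_mul hb]
  linarith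

lemma integral_gammaMeasure {ρ b : ℝ} (hρ : 0 < ρ) (hb : 0 < b) (f : ℝ → ℝ) :
    ∫ x, f x ∂gammaMeasure ρ b =
      ∫ x in Set.Ioi 0, b ^ ρ / Real.Gamma ρ * (x ^ (ρ - 1) * Real.exp (-(b * x))) * f x := by
  rw [gammaMeasure, integral_withDensity_eq_integral_toReal_smul
    (f := gammaPDF ρ b) (measurable_gammaPDFReal ρ b).ennreal_ofReal
    (Filter.Eventually.of_forall fun _ => ENNReal.ofReal_lt_top)]
  rw [← integral_Ici_eq_integral_Ioi, ← integral_indicator measurableSet_Ici]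
  refine integral_congr_ae (Filter.Eventually.of_forall fun x => ?_)
  simp only [Set.indicator_apply, Set.mem_Ici, gammaPDF, smul_eq_mul]
  rw [ENNReal.toReal_ofReal (gammaPDFReal_nonneg hρ hb x), gammaPDFReal]
  split_ifs
  · ring
  · simp

/-- Integration by parts trades the jump of the indicator of u ≥ T, T = c^(-1/r), for the continuous
factor 1 - (T/u)^ρ, which is a multiple of the kernel with Ψ = ρ/r at c u^r. The price is that the
shape rises from ρ to ρ + 1. -/
lemma gammaMeasure_real_tail {ρ b c : ℝ} {r : ℕ} (hρ : 0 < ρ) (hb : 0 < b) (hc : 0 < c)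
    (hr : 0 < r) :
    (gammaMeasure ρ b).real {u | 1 ≤ c * u ^ r} =
      ∫ u in Set.Ioi 0, b ^ (ρ + 1) / (r * Real.Gamma ρ) * (u ^ ρ * Real.exp (-(b * u))) *
        perronKernel (ρ / r) (c * u ^ r) := by
  have hr' : (0 : ℝ) < r := by exact_mod_cast hr
  have hG := Real.Gamma_pos_of_pos hρ
  obtain ⟨T, hT, hcT⟩ : ∃ T : ℝ, 0 < T ∧ c = (T ^ r)⁻¹ := by
    refine ⟨(c⁻¹) ^ (1 / (r : ℝ)), by positivity, ?_⟩
    rw [← Real.rpow_natCast, ← Real.rpow_mul (by positivity), one_div,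
      inv_mul_cancel₀ hr'.ne', Real.rpow_one, inv_inv]
  have hiff : ∀ u : ℝ, 0 < u → (1 ≤ c * u ^ r ↔ T ≤ u) := by
    intro u hu
    rw [hcT, inv_mul_eq_div, one_le_div (by positivity)]
    exact pow_le_pow_iff_left₀ hT.le hu.le hr.ne'
  have hms : MeasurableSet {u : ℝ | 1 ≤ c * u ^ r} :=
    measurableSet_le (measurable_const (a := (1 : ℝ))) (by fun_prop)
  -- For even r the event also contains negative u; the gamma law does not charge them.
  rw [← integral_indicator_one hms, integral_gammaMeasure hρ hb]
  have hsub : Set.Ioi T ⊆ Set.Ioi 0 := Set.Ioi_subset_Ioi hT.le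
  have step : ∀ f : ℝ → ℝ, (∀ u, 0 < u → u < T → f u = 0) →
      ∫ u in Set.Ioi 0, f u = ∫ u in Set.Ioi T, f u := by
    intro f hf
    rw [← integral_Ici_eq_integral_Ioi (x := T)]
    refine setIntegral_eq_of_subset_of_forall_sdiff_eq_zero measurableSet_Ioi ?_ ?_
    · exact fun x (hx : T ≤ x) => Set.mem_Ioi.2 (hT.trans_le hx)
    · intro x hx
      exact hf x hx.1 (not_le.1 hx.2)
  rw [step, step]
  · have h := upper_incomplete_gamma hρ hb hT
    rw [integral_const_mul, integral_const_mul] at h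
    have e1 : ∫ u in Set.Ioi T, b ^ ρ / Real.Gamma ρ * (u ^ (ρ - 1) * Real.exp (-(b * u))) *
        Set.indicator {u : ℝ | 1 ≤ c * u ^ r} 1 u =
        b ^ ρ / Real.Gamma ρ * ∫ u in Set.Ioi T, u ^ (ρ - 1) * Real.exp (-(b * u)) := by
      rw [← integral_const_mul]
      refine setIntegral_congr_fun measurableSet_Ioi fun u hu => ?_
      rw [Set.indicator_of_mem (show u ∈ {u : ℝ | 1 ≤ c * u ^ r} from
        (hiff u (hT.trans hu)).2 (le_of_lt hu))]
      simp
    have e2 : ∫ u in Set.Ioi T, b ^ (ρ + 1) / (r * Real.Gamma ρ) *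
        (u ^ ρ * Real.exp (-(b * u))) * perronKernel (ρ / r) (c * u ^ r) =
        b ^ (ρ + 1) / (ρ * Real.Gamma ρ) *
          ∫ u in Set.Ioi T, (u ^ ρ - T ^ ρ) * Real.exp (-(b * u)) := by
      rw [← integral_const_mul]
      refine setIntegral_congr_fun measurableSet_Ioi fun u hu => ?_
      have hu0 : 0 < u := hT.trans hu
      rw [perronKernel, if_pos ((hiff u hu0).2 (le_of_lt hu))]
      have : (c * u ^ r) ^ (-(ρ / r)) = T ^ ρ / u ^ ρ := by
        rw [hcT, inv_mul_eq_div, ← div_pow, ← Real.rpow_natCast, ← Real.rpow_mul (by positivity),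
          show (r : ℝ) * -(ρ / r) = -ρ by field_simp, Real.rpow_neg (by positivity),
          Real.div_rpow hu0.le hT.le, inv_div]
      rw [this]
      have := Real.rpow_pos_of_pos hu0 ρ
      field_simp
    rw [e1, e2, Real.rpow_add hb, Real.rpow_one]
    have h' : ∫ u in Set.Ioi T, u ^ (ρ - 1) * Real.exp (-(b * u)) =
        b / ρ * ∫ u in Set.Ioi T, (u ^ ρ - T ^ ρ) * Real.exp (-(b * u)) := by
      field_simp
      linarith
    rw [h']
    field_simp
  · intro u hu huT
    rw [perronKernel, if_neg (by rw [hiff u hu]; exact not_le.2 huT), mul_zero]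
  · intro u hu huT
    rw [Set.indicator_of_notMem (by
      simp only [Set.mem_ofPred_eq]; rw [hiff u hu]; exact not_le.2 huT), mul_zero]

/-- The Mellin transform of a gamma density. -/
lemma integral_cpow_gamma {q b : ℝ} {s : ℂ} (hq : 0 < ((q : ℂ) + s).re) (hb : 0 < b) :
    ∫ u : ℝ in Set.Ioi 0, ((u ^ (q - 1) * Real.exp (-(b * u)) : ℝ) : ℂ) * (u : ℂ) ^ s =
      (b : ℂ) ^ (-((q : ℂ) + s)) * Complex.Gamma (q + s) := by
  have h := Complex.integral_cpow_mul_exp_neg_mul_Ioi hq hb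
  rw [one_div, Complex.inv_cpow _ _ (by
    rw [Complex.arg_ofReal_of_nonneg hb.le]; exact Real.pi_pos.ne), ← Complex.cpow_neg] at h
  rw [← h]
  refine setIntegral_congr_fun measurableSet_Ioi fun u hu => ?_
  have hu0 : (u : ℂ) ≠ 0 := by exact_mod_cast (ne_of_gt hu)
  push_cast [Complex.ofReal_cpow (le_of_lt hu)]
  rw [show (q : ℂ) + s - 1 = (q - 1) + s by ring, Complex.cpow_add _ _ hu0]
  ring

/-- `P(V ^ r₂ ≤ y U ^ r₁)` for independent gamma variables `U` and `V`, as a Mellin–Barnes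
integral. -/
lemma gamma_comparison {ρ₁ b₁ ρ₂ b₂ y σ : ℝ} {r₁ r₂ : ℕ} (hρ₁ : 0 < ρ₁) (hb₁ : 0 < b₁)
    (hρ₂ : 0 < ρ₂) (hb₂ : 0 < b₂) (hy : 0 < y) (hr₁ : 0 < r₁) (hσ : 0 < σ)
    (hσ2 : r₂ * σ < ρ₂) :
    ((∫ v, (gammaMeasure ρ₁ b₁).real {u | v ^ r₂ ≤ y * u ^ r₁} ∂gammaMeasure ρ₂ b₂ : ℝ) : ℂ) =
      1 / (2 * (Real.pi : ℂ)) * ∫ t : ℝ, (fun s : ℂ =>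
        Complex.Gamma (ρ₁ + r₁ * s) * Complex.Gamma (ρ₂ - r₂ * s) /
          (s * (Real.Gamma ρ₁ * Real.Gamma ρ₂ : ℝ)) *
          ((y * b₂ ^ r₂ / b₁ ^ r₁ : ℝ) : ℂ) ^ s) (σ + t * Complex.I) := by
  have hr : (0 : ℝ) < r₁ := by exact_mod_cast hr₁
  have hG₁ := Real.Gamma_pos_of_pos hρ₁
  have hG₂ := Real.Gamma_pos_of_pos hρ₂
  -- The first coordinate is v and the second u. The weight `w₁` is the one produced by integration
  -- by parts, with exponent ρ₁ instead of ρ₁ - 1; `w₂` is the density of V.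
  set ν : Measure (ℝ × ℝ) := (volume.restrict (Set.Ioi 0)).prod (volume.restrict (Set.Ioi 0))
  set K₁ : ℝ := b₁ ^ (ρ₁ + 1) / (r₁ * Real.Gamma ρ₁) with hK₁
  set K₂ : ℝ := b₂ ^ ρ₂ / Real.Gamma ρ₂ with hK₂
  set w₂ : ℝ → ℝ := fun v => K₂ * (v ^ (ρ₂ - 1) * Real.exp (-(b₂ * v)))
  set w₁ : ℝ → ℝ := fun u => K₁ * (u ^ ρ₁ * Real.exp (-(b₁ * u)))
  set Y : ℝ × ℝ → ℝ := fun z => y / z.1 ^ r₂ * z.2 ^ r₁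
  have hpp : ∀ᵐ z ∂ν, 0 < z.1 ∧ 0 < z.2 := by
    have h0 : ∀ᵐ x : ℝ ∂volume.restrict (Set.Ioi 0), 0 < x := ae_restrict_mem measurableSet_Ioi
    exact (Measure.quasiMeasurePreserving_fst.ae h0).and (Measure.quasiMeasurePreserving_snd.ae h0)
  have hYpos : ∀ᵐ z ∂ν, 0 < Y z := by
    filter_upwards [hpp] with z hz
    have := hz.1
    have := hz.2
    positivity
  have hYm : Measurable Y := by fun_prop
  have hwm : Measurable fun z : ℝ × ℝ => w₂ z.1 * w₁ z.2 := by fun_prop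
  have hi₁ : Integrable w₁ (volume.restrict (Set.Ioi 0)) :=
    (integrableOn_rpow_mul_exp_neg (by linarith) hb₁).const_mul _
  have hi₂ : Integrable w₂ (volume.restrict (Set.Ioi 0)) :=
    (integrableOn_rpow_mul_exp_neg (by linarith) hb₂).const_mul _
  have hΨ : 0 < ρ₁ / r₁ := by positivity
  have hlhs : ∫ v, (gammaMeasure ρ₁ b₁).real {u | v ^ r₂ ≤ y * u ^ r₁} ∂gammaMeasure ρ₂ b₂ =
      ∫ z, w₂ z.1 * w₁ z.2 * perronKernel (ρ₁ / r₁) (Y z) ∂ν := by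
    rw [integral_gammaMeasure hρ₂ hb₂, integral_prod]
    · refine setIntegral_congr_fun measurableSet_Ioi fun v hv => ?_
      have hv' : 0 < v := hv
      have hset : {u : ℝ | v ^ r₂ ≤ y * u ^ r₁} = {u | 1 ≤ y / v ^ r₂ * u ^ r₁} := by
        ext u
        simp only [Set.mem_ofPred_eq]
        rw [div_mul_eq_mul_div, one_le_div (by positivity)]
      rw [hset, gammaMeasure_real_tail hρ₁ hb₁ (by positivity) hr₁, ← integral_const_mul]
      refine integral_congr_ae (Filter.Eventually.of_forall fun u => ?_)
      simp only [w₁, w₂, Y, K₁, K₂]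
      ring
    · refine ((hi₂.mul_prod hi₁).norm.const_mul (1 / (ρ₁ / r₁))).mono' ?_ ?_
      · exact (hwm.mul ((measurable_perronKernel _).comp hYm)).aestronglyMeasurable
      · refine Filter.Eventually.of_forall fun z => ?_
        rw [norm_mul, Real.norm_of_nonneg (perronKernel_nonneg hΨ _), mul_comm]
        gcongr
        exact perronKernel_le hΨ _
  have hint : Integrable (fun z : ℝ × ℝ => w₂ z.1 * w₁ z.2 * Y z ^ σ) ν := by
    have j₁ : Integrable (fun u : ℝ => K₁ * (u ^ (ρ₁ + r₁ * σ) * Real.exp (-(b₁ * u))))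
        (volume.restrict (Set.Ioi 0)) :=
      (integrableOn_rpow_mul_exp_neg (by nlinarith [mul_pos hr hσ]) hb₁).const_mul _
    have j₂ : Integrable (fun v : ℝ => y ^ σ * (K₂ * (v ^ (ρ₂ - 1 - r₂ * σ) *
        Real.exp (-(b₂ * v))))) (volume.restrict (Set.Ioi 0)) :=
      ((integrableOn_rpow_mul_exp_neg (by linarith) hb₂).const_mul _).const_mul _
    refine (j₂.mul_prod j₁).congr ?_
    filter_upwards [hpp] with z hz
    have h1 := hz.1
    have h2 := hz.2
    simp only [w₁, w₂, Y]
    rw [Real.mul_rpow (by positivity) (by positivity), Real.div_rpow hy.le (by positivity),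
      ← Real.rpow_natCast_mul h1.le, ← Real.rpow_natCast_mul h2.le, Real.rpow_add h2,
      Real.rpow_sub h1]
    ring
  -- The Mellin moment factors over u and v; the upper bound on Re s is what makes the moment of
  -- v^(-r₂ s) converge.
  have hmom : ∀ s : ℂ, 0 < s.re → r₂ * s.re < ρ₂ →
      ∫ z, ((w₂ z.1 * w₁ z.2 : ℝ) : ℂ) * (Y z : ℂ) ^ s ∂ν =
        Complex.Gamma (ρ₁ + 1 + r₁ * s) * Complex.Gamma (ρ₂ - r₂ * s) /
          (r₁ * (Real.Gamma ρ₁ * Real.Gamma ρ₂ : ℝ)) *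
          ((y * b₂ ^ r₂ / b₁ ^ r₁ : ℝ) : ℂ) ^ s := by
    intro s hs hs2
    have m₁ := integral_cpow_gamma (q := ρ₁ + 1) (s := r₁ * s) (b := b₁)
      (by simp; nlinarith [mul_pos hr hs]) hb₁
    have m₂ := integral_cpow_gamma (q := ρ₂) (s := -(r₂ * s)) (b := b₂)
      (by simp; linarith) hb₂
    have hb₁' : (b₁ : ℂ) ≠ 0 := by exact_mod_cast hb₁.ne'
    have hb₂' : (b₂ : ℂ) ≠ 0 := by exact_mod_cast hb₂.ne'
    have hpow : ∀ (x : ℝ) (k : ℕ), 0 ≤ x → ((x ^ k : ℝ) : ℂ) ^ s = (x : ℂ) ^ ((k : ℂ) * s) := by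
      intro x k hx
      have h0 : (x : ℂ).arg = 0 := Complex.arg_ofReal_of_nonneg hx
      rw [Complex.ofReal_pow, Complex.cpow_nat_mul' (by rw [h0]; simpa using Real.pi_pos)
        (by rw [h0]; simpa using Real.pi_pos.le)]
    have e : ∫ z, ((w₂ z.1 * w₁ z.2 : ℝ) : ℂ) * (Y z : ℂ) ^ s ∂ν =
        ∫ z : ℝ × ℝ, ((y : ℂ) ^ s * K₂ * (((z.1 ^ (ρ₂ - 1) * Real.exp (-(b₂ * z.1)) : ℝ) : ℂ) *
            (z.1 : ℂ) ^ (-(r₂ * s)))) *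
          ((K₁ : ℂ) * (((z.2 ^ (ρ₁ + 1 - 1) * Real.exp (-(b₁ * z.2)) : ℝ) : ℂ) *
            (z.2 : ℂ) ^ (r₁ * s))) ∂ν := by
      refine integral_congr_ae ?_
      filter_upwards [hpp] with z hz
      have h1 := hz.1
      have h2 := hz.2
      have hY : (Y z : ℂ) ^ s =
          (y : ℂ) ^ s * (z.1 : ℂ) ^ (-(r₂ * s)) * (z.2 : ℂ) ^ (r₁ * s) := by
        simp only [Y]
        rw [div_eq_mul_inv, Complex.ofReal_mul, Complex.mul_cpow_ofReal_nonneg (by positivity)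
          (by positivity), Complex.ofReal_mul, Complex.mul_cpow_ofReal_nonneg hy.le
          (by positivity), hpow _ _ h2.le, Complex.ofReal_inv, Complex.inv_cpow, hpow _ _ h1.le,
          Complex.cpow_neg]
        rw [Complex.arg_ofReal_of_nonneg (by positivity)]
        exact Real.pi_pos.ne
      rw [hY]
      simp only [w₁, w₂, add_sub_cancel_right]
      push_cast
      ring
    rw [e, integral_prod_mul (μ := volume.restrict (Set.Ioi (0:ℝ)))
      (ν := volume.restrict (Set.Ioi (0:ℝ))) (fun v : ℝ => (y : ℂ) ^ s * K₂ *
        (((v ^ (ρ₂ - 1) * Real.exp (-(b₂ * v)) : ℝ) : ℂ) * (v : ℂ) ^ (-(r₂ * s))))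
      (fun u : ℝ => (K₁ : ℂ) * (((u ^ (ρ₁ + 1 - 1) * Real.exp (-(b₁ * u)) : ℝ) : ℂ) *
            (u : ℂ) ^ (r₁ * s))), integral_const_mul, integral_const_mul, m₁, m₂]
    have hZ : ((y * b₂ ^ r₂ / b₁ ^ r₁ : ℝ) : ℂ) ^ s =
        (y : ℂ) ^ s * (b₂ : ℂ) ^ (r₂ * s) * ((b₁ : ℂ) ^ (r₁ * s))⁻¹ := by
      rw [div_eq_mul_inv, Complex.ofReal_mul, Complex.mul_cpow_ofReal_nonneg (by positivity)
          (by positivity), Complex.ofReal_mul, Complex.mul_cpow_ofReal_nonneg hy.le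
          (by positivity), hpow _ _ hb₂.le, Complex.ofReal_inv, Complex.inv_cpow, hpow _ _ hb₁.le]
      rw [Complex.arg_ofReal_of_nonneg (by positivity)]
      exact Real.pi_pos.ne
    rw [hZ, hK₁, hK₂, neg_add, neg_add, neg_neg, Complex.cpow_add _ _ hb₁',
      Complex.cpow_add _ _ hb₂', Complex.cpow_neg, Complex.cpow_neg, Complex.cpow_neg]
    push_cast [Complex.ofReal_cpow hb₁.le, Complex.ofReal_cpow hb₂.le]
    have n1 : (b₁ : ℂ) ^ ((ρ₁ : ℂ) + 1) ≠ 0 := by simp [Complex.cpow_eq_zero_iff, hb₁']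
    have n2 : (b₂ : ℂ) ^ (ρ₂ : ℂ) ≠ 0 := by simp [Complex.cpow_eq_zero_iff, hb₂']
    have n3 : (Complex.ofReal (Real.Gamma ρ₁)) ≠ 0 := by exact_mod_cast hG₁.ne'
    have n4 : (Complex.ofReal (Real.Gamma ρ₂)) ≠ 0 := by exact_mod_cast hG₂.ne'
    rw [← sub_eq_add_neg]
    field_simp
  rw [hlhs, ← perron_integral ν hΨ hσ hwm hYm hYpos hint]
  congr 1
  refine integral_congr_ae (Filter.Eventually.of_forall fun t => ?_)
  beta_reduce
  set s : ℂ := σ + t * Complex.I with hs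
  have hsre : s.re = σ := by simp [hs]
  rw [hmom s (by rw [hsre]; exact hσ) (by rw [hsre]; exact hσ2)]
  have hs0 : s ≠ 0 := line_ne_zero hσ t
  have hrc : (r₁ : ℂ) ≠ 0 := by exact_mod_cast hr₁.ne'
  have hne : (ρ₁ : ℂ) + r₁ * s ≠ 0 := by
    intro h
    have := congrArg Complex.re h
    simp [hsre] at this
    nlinarith [mul_pos hr hσ]
  have hne' : s + ((ρ₁ / r₁ : ℝ) : ℂ) ≠ 0 := by
    intro h
    apply hne
    have : (ρ₁ : ℂ) + r₁ * s = r₁ * (s + ((ρ₁ / r₁ : ℝ) : ℂ)) := by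
      push_cast; field_simp; ring
    rw [this, h, mul_zero]
  -- The factor ρ₁ + r₁ s = r₁(s + ρ₁/r₁) released by the functional equation cancels the factor s +
  -- Ψ of the kernel and the r₁ of `K₁`, so only 1/s survives.
  rw [show (ρ₁ : ℂ) + 1 + r₁ * s = (ρ₁ + r₁ * s) + 1 by ring, Complex.Gamma_add_one _ hne,
    show (ρ₁ : ℂ) + r₁ * s = r₁ * (s + ((ρ₁ / r₁ : ℝ) : ℂ)) by push_cast; field_simp; ring]
  have n3 : (Complex.ofReal (Real.Gamma ρ₁)) ≠ 0 := by exact_mod_cast hG₁.ne'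
  have n4 : (Complex.ofReal (Real.Gamma ρ₂)) ≠ 0 := by exact_mod_cast hG₂.ne'
  have hne2 : s * r₁ + ρ₁ ≠ 0 := by rw [mul_comm, add_comm]; exact hne
  push_cast at hne' ⊢
  field_simp

/-! ### The optical hop -/

lemma φ_pos (Rs : ℝ) : 0 < φ Rs := Real.rpow_pos_of_pos two_pos Rs

lemma one_lt_φ {Rs : ℝ} (h : 0 < Rs) : 1 < φ Rs := Real.one_lt_rpow one_lt_two h

/-- Both sides are the product measure of the event γ_D ≤ c γ_E. Fubini makes the eavesdropper's
variable the inner one, so that the inner probability is an upper tail as in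
`gammaMeasure_real_tail`. -/
lemma integral_snrCDF (D E : RISLink) {c : ℝ} (hc : 0 < c) :
    ∫ γ, D.snrCDF (c * γ) ∂E.snrLaw =
      ∫ v, (gammaMeasure E.ρ (1 / E.w)).real
        {u | v ^ D.r ≤ c * E.τ * D.meanY ^ D.r / (E.meanY ^ E.r * D.τ) * u ^ E.r}
        ∂gammaMeasure D.ρ (1 / D.w) := by
  have := D.isProbabilityMeasure_gamma
  have := E.isProbabilityMeasure_gamma
  have hmD := D.meanY_pos
  have hmE := E.meanY_pos
  have hτD := D.τ_pos
  have hτE := E.τ_pos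
  set y := c * E.τ * D.meanY ^ D.r / (E.meanY ^ E.r * D.τ) with hy
  set S : Set (ℝ × ℝ) := {z | z.2 ^ D.r ≤ y * z.1 ^ E.r} with hS
  have hSm : MeasurableSet S := measurableSet_le (by fun_prop) (by fun_prop)
  have hmeas : Measurable fun γ => D.snrCDF (c * γ) :=
    D.monotone_snrCDF.measurable.comp (measurable_const_mul c)
  rw [RISLink.snrLaw, integral_map E.measurable_snr.aemeasurable hmeas.aestronglyMeasurable]
  have h1 : ∀ u, D.snrCDF (c * (E.τ * (u / E.meanY) ^ E.r)) =
      ∫ v, S.indicator (fun _ => (1 : ℝ)) (u, v) ∂gammaMeasure D.ρ (1 / D.w) := by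
    intro u
    rw [RISLink.snrCDF, RISLink.snrLaw, map_measureReal_apply D.measurable_snr measurableSet_Iic,
      ← integral_indicator_one (D.measurable_snr measurableSet_Iic)]
    refine integral_congr_ae (Filter.Eventually.of_forall fun v => ?_)
    have hiff : D.τ * (v / D.meanY) ^ D.r ≤ c * (E.τ * (u / E.meanY) ^ E.r) ↔
        v ^ D.r ≤ y * u ^ E.r := by
      have e : y * u ^ E.r = c * (E.τ * (u / E.meanY) ^ E.r) * (D.meanY ^ D.r / D.τ) := by
        rw [hy, div_pow]; field_simp
      have e' : v ^ D.r = D.τ * (v / D.meanY) ^ D.r * (D.meanY ^ D.r / D.τ) := by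
        rw [div_pow]; field_simp
      rw [e, e']
      exact (mul_le_mul_iff_left₀ (by positivity)).symm
    beta_reduce
    by_cases hv : v ^ D.r ≤ y * u ^ E.r
    · rw [Set.indicator_of_mem (show (u, v) ∈ S from hv), Set.indicator_of_mem]
      · rfl
      · exact hiff.2 hv
    · rw [Set.indicator_of_notMem (show (u, v) ∉ S from hv), Set.indicator_of_notMem]
      exact fun h => hv (hiff.1 h)
  have h2 : ∀ v, (gammaMeasure E.ρ (1 / E.w)).real {u | v ^ D.r ≤ y * u ^ E.r} =
      ∫ u, S.indicator (fun _ => (1 : ℝ)) (u, v) ∂gammaMeasure E.ρ (1 / E.w) := by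
    intro v
    rw [← integral_indicator_one (measurableSet_le (by fun_prop) (by fun_prop))]
    rfl
  simp_rw [h1, h2]
  refine integral_integral_swap ?_
  exact (integrable_const (1 : ℝ)).indicator hSm

/-! ### From the Mellin–Barnes integral to the optical Meijer G-function -/

/-- The multiplication theorem of the gamma function for `r ≤ 2`. -/
lemma prod_Gamma_add_div {r : ℕ} (hr : r = 1 ∨ r = 2) (z : ℂ) :
    ((List.range r).map fun k : ℕ => Complex.Gamma (z + (k : ℂ) / r)).prod =
      (((2 * Real.pi) ^ (((r : ℝ) - 1) / 2) * (r : ℝ) ^ (1 / 2 : ℝ) : ℝ) : ℂ) *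
        (r : ℂ) ^ (-(r * z)) * Complex.Gamma (r * z) := by
  rcases hr with rfl | rfl
  · simp
  · have h := Complex.Gamma_mul_Gamma_add_half z
    simp only [List.range_succ, List.range_zero, List.nil_append, List.map_append, List.map_cons,
      List.map_nil, List.prod_append, List.prod_cons, List.prod_nil, mul_one]
    push_cast
    rw [zero_div, add_zero, h, Complex.cpow_sub _ _ two_ne_zero, Complex.cpow_one,
      Complex.cpow_neg]
    have e : ((2 * Real.pi) ^ (((2 : ℝ) - 1) / 2) * 2 ^ (1 / 2 : ℝ) : ℝ) = 2 * √Real.pi := by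
      rw [show ((2 : ℝ) - 1) / 2 = 1 / 2 by norm_num, ← Real.sqrt_eq_rpow, ← Real.sqrt_eq_rpow,
        Real.sqrt_mul zero_le_two, mul_right_comm, Real.mul_self_sqrt zero_le_two]
    have e' := congrArg Complex.ofReal e
    push_cast at e'
    rw [e']
    ring

/-- Bookkeeping of the prefactors, with index 1 for the eavesdropper, 2 for the destination, G for
Γ(ρ), c for φ and P for 2π. Writing every base as an exponential reduces the identity to one between
exponents. -/
lemma optical_constant {m₁ w₁ τ₁ r₁ G₁ m₂ w₂ τ₂ r₂ G₂ c P ρ₁ ρ₂ : ℝ} (hm₁ : 0 < m₁)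
    (hw₁ : 0 < w₁) (hτ₁ : 0 < τ₁) (hr₁ : 0 < r₁) (hG₁ : 0 < G₁) (hm₂ : 0 < m₂) (hw₂ : 0 < w₂)
    (hτ₂ : 0 < τ₂) (hr₂ : 0 < r₂) (hG₂ : 0 < G₂) (hc : 0 < c) (hP : 0 < P) :
    c ^ (ρ₂ / r₂) * (m₂ ^ ρ₂ / (r₂ ^ (1 / 2 : ℝ) * G₂ * w₂ ^ ρ₂ * τ₂ ^ (ρ₂ / r₂) *
        P ^ ((r₂ - 1) / 2))) *
      (m₁ ^ ρ₁ / (r₁ * G₁ * w₁ ^ ρ₁ * τ₁ ^ (ρ₁ / r₁))) *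
      (r₁ ^ (1 / 2 : ℝ) * (c * (m₂ ^ r₂ / (r₂ ^ r₂ * w₂ ^ r₂ * τ₂))) ^ (-(ρ₂ / r₂ + ρ₁ / r₁)) /
        P ^ (1 / 2 * (r₁ - 1))) *
      (P ^ ((r₁ - 1) / 2) * r₁ ^ (1 / 2 : ℝ)) *
      (P ^ ((r₂ - 1) / 2) * r₂ ^ (1 / 2 : ℝ)) * r₂ ^ (-(r₂ * (ρ₂ / r₂ + ρ₁ / r₁))) =
    (c * τ₁ * m₂ ^ r₂ / (m₁ ^ r₁ * τ₂) * (1 / w₂) ^ r₂ / (1 / w₁) ^ r₁) ^ (-(ρ₁ / r₁)) /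
      (G₁ * G₂) := by
  have hex : ∀ x : ℝ, 0 < x → ∃ l, x = Real.exp l := fun x hx =>
    ⟨Real.log x, (Real.exp_log hx).symm⟩
  have hR₁ := hr₁.ne'
  have hR₂ := hr₂.ne'
  -- `r₁` and `r₂` are not replaced by exponentials, because they also occur in exponents; only
  -- their occurrences as bases and factors are rewritten.
  obtain ⟨lr₁, h₁⟩ := hex r₁ hr₁
  obtain ⟨lr₂, h₂⟩ := hex r₂ hr₂
  obtain ⟨lm₁, rfl⟩ := hex m₁ hm₁
  obtain ⟨lw₁, rfl⟩ := hex w₁ hw₁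
  obtain ⟨lτ₁, rfl⟩ := hex τ₁ hτ₁
  obtain ⟨lG₁, rfl⟩ := hex G₁ hG₁
  obtain ⟨lm₂, rfl⟩ := hex m₂ hm₂
  obtain ⟨lw₂, rfl⟩ := hex w₂ hw₂
  obtain ⟨lτ₂, rfl⟩ := hex τ₂ hτ₂
  obtain ⟨lG₂, rfl⟩ := hex G₂ hG₂
  obtain ⟨lc, rfl⟩ := hex c hc
  obtain ⟨lP, rfl⟩ := hex P hP
  have p₁ : ∀ a, r₁ ^ a = Real.exp (lr₁ * a) := fun a => by
    rw [Real.exp_mul, ← h₁]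
  have p₂ : ∀ a, r₂ ^ a = Real.exp (lr₂ * a) := fun a => by
    rw [Real.exp_mul, ← h₂]
  have q : ∀ X : ℝ, r₁ * X = Real.exp lr₁ * X := fun X => by rw [← h₁]
  simp only [p₁, p₂]
  simp only [mul_assoc, q]
  simp only [← Real.exp_mul, ← Real.exp_add, ← Real.exp_neg, div_eq_mul_inv, one_mul]
  congr 1
  field_simp
  ring

lemma exists_optical_line (D E : RISLink) :
    ∃ σ : ℝ, IsMeijerLine (E.r + 1) D.r (upperParams D E) (lowerParams E) σ := by
  have hD := div_pos D.ρ_pos D.r_cast_pos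
  have hE := div_pos E.ρ_pos E.r_cast_pos
  -- The midpoint of the strip -ζ < σ < -ρ_E/r_E, whose width is ρ_D/r_D.
  refine ⟨-(E.ρ / E.r) - D.ρ / D.r / 2, ?_, ?_⟩
  · intro x hx
    rw [upperParams, List.take_left' (by simp)] at hx
    simp only [List.mem_map, List.mem_range] at hx
    obtain ⟨k, -, rfl⟩ := hx
    have : (0 : ℝ) ≤ (k : ℝ) / D.r := by positivity
    rw [ζ]
    linarith
  · intro x hx
    have hx' := List.mem_of_mem_take hx
    simp only [lowerParams, List.mem_append, List.mem_map, List.mem_range, List.mem_singleton] at hx'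
    rcases hx' with ⟨k, -, rfl⟩ | rfl
    · have : (0 : ℝ) ≤ (k : ℝ) / E.r := by positivity
      linarith
    · linarith

/-- These are the two binding constraints. Under s' = -ρ_E/r_E - s the strip becomes 0 < Re s' <
ρ_D/r_D, the range required by `gamma_comparison`. -/
lemma optical_line_bounds {D E : RISLink} {σ : ℝ}
    (h : IsMeijerLine (E.r + 1) D.r (upperParams D E) (lowerParams E) σ) :
    -ζ D E < σ ∧ σ < -(E.ρ / E.r) := by
  constructor
  · have := h.1 (1 - ζ D E) (by
      rw [upperParams, List.take_left' (by simp)]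
      simp only [List.mem_map, List.mem_range]
      exact ⟨0, D.r_pos, by simp⟩)
    linarith
  · refine h.2 _ ?_
    rw [List.take_of_length_le (by simp [lowerParams])]
    simp [lowerParams]

/-- The factors Γ(k/r_E - s) merge into Γ(ρ_E + r_E s') and the factors Γ(ζ + s + k/r_D) into Γ(ρ_D
- r_D s'), by the multiplication theorem; the remaining quotient is Γ(s')/Γ(s'+1) = 1/s'. The powers
r^(r s) so created cancel those in Ω₁₈^s, and the other constants match by `optical_constant`. -/
lemma optical_integrand (D E : RISLink) {Rs : ℝ} {s s' : ℂ} (hs' : s' ≠ 0)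
    (hss : s' = -((E.ρ / E.r : ℝ) : ℂ) - s)
    (hpole : ∀ m : ℕ, s' ≠ -m) :
    ((Υ₃' D Rs * E.Υ₁ * ((E.r : ℝ) ^ (1 / 2 : ℝ) * Υ₄' D Rs ^ (-ζ D E) /
      (2 * Real.pi) ^ (1 / 2 * ((E.r : ℝ) - 1))) : ℝ) : ℂ) *
        meijerIntegrand (E.r + 1) D.r (upperParams D E) (lowerParams E) (Ω₁₈ D E Rs) s =
      Complex.Gamma (E.ρ + E.r * s') * Complex.Gamma (D.ρ - D.r * s') /
          (s' * (Real.Gamma E.ρ * Real.Gamma D.ρ : ℝ)) *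
          ((φ Rs * E.τ * D.meanY ^ D.r / (E.meanY ^ E.r * D.τ) * (1 / D.w) ^ D.r /
            (1 / E.w) ^ E.r : ℝ) : ℂ) ^ s' := by
  have hmD := D.meanY_pos
  have hmE := E.meanY_pos
  have hτD := D.τ_pos
  have hτE := E.τ_pos
  have hwD := D.w_pos
  have hwE := E.w_pos
  have hrD := D.r_cast_pos
  have hrE := E.r_cast_pos
  have hφ := φ_pos Rs
  have hGE := Real.Gamma_pos_of_pos E.ρ_pos
  have hGD := Real.Gamma_pos_of_pos D.ρ_pos
  have hrDc : (D.r : ℂ) ≠ 0 := by exact_mod_cast hrD.ne'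
  have hrEc : (E.r : ℂ) ≠ 0 := by exact_mod_cast hrE.ne'
  set Z : ℝ := φ Rs * E.τ * D.meanY ^ D.r / (E.meanY ^ E.r * D.τ) * (1 / D.w) ^ D.r /
            (1 / E.w) ^ E.r with hZ
  have hZpos : 0 < Z := by positivity
  set C : ℝ := Υ₃' D Rs * E.Υ₁ * ((E.r : ℝ) ^ (1 / 2 : ℝ) * Υ₄' D Rs ^ (-ζ D E) /
      (2 * Real.pi) ^ (1 / 2 * ((E.r : ℝ) - 1))) with hC
  have hconst : C * ((2 * Real.pi) ^ (((E.r : ℝ) - 1) / 2) * (E.r : ℝ) ^ (1 / 2 : ℝ)) *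
      ((2 * Real.pi) ^ (((D.r : ℝ) - 1) / 2) * (D.r : ℝ) ^ (1 / 2 : ℝ)) *
        (D.r : ℝ) ^ (-(D.r * ζ D E)) =
      Z ^ (-(E.ρ / E.r)) / (Real.Gamma E.ρ * Real.Gamma D.ρ) := by
    have h := optical_constant (ρ₁ := E.ρ) (ρ₂ := D.ρ) hmE hwE hτE hrE hGE hmD hwD hτD hrD hGD hφ
      (P := 2 * Real.pi) (by positivity)
    simp only [Real.rpow_natCast] at h
    rw [hZ, ← h, hC, Υ₃', Υ₄', RISLink.Υ₃, RISLink.Υ₁, RISLink.Υ₄, ζ, Real.sqrt_eq_rpow]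
  have hΩ : Ω₁₈ D E Rs = (D.r : ℝ) ^ D.r * (((E.r : ℝ) ^ E.r)⁻¹ * Z⁻¹) := by
    have e : (E.τ ^ (1 / (E.r : ℝ))) ^ E.r = E.τ := by
      rw [← Real.rpow_natCast, ← Real.rpow_mul hτE.le, one_div, inv_mul_cancel₀ hrE.ne',
        Real.rpow_one]
    rw [Ω₁₈, Υ₄', RISLink.Υ₄, RISLink.Υ₂, div_pow, mul_pow, e, hZ, one_div, one_div, inv_pow,
      inv_pow]
    field_simp
  have hpow : ∀ (x : ℝ) (k : ℕ), 0 ≤ x → ((x ^ k : ℝ) : ℂ) ^ s = (x : ℂ) ^ ((k : ℂ) * s) := by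
    intro x k hx
    have h0 : (x : ℂ).arg = 0 := Complex.arg_ofReal_of_nonneg hx
    rw [Complex.ofReal_pow, Complex.cpow_nat_mul' (by rw [h0]; simpa using Real.pi_pos)
      (by rw [h0]; simpa using Real.pi_pos.le)]
  have hinv : ∀ (x : ℝ), 0 ≤ x → ((x⁻¹ : ℝ) : ℂ) ^ s = ((x : ℂ) ^ s)⁻¹ := by
    intro x hx
    rw [Complex.ofReal_inv, Complex.inv_cpow]
    rw [Complex.arg_ofReal_of_nonneg hx]
    exact Real.pi_pos.ne
  have hΩs : ((Ω₁₈ D E Rs : ℝ) : ℂ) ^ s =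
      (D.r : ℂ) ^ (D.r * s) * (((E.r : ℂ) ^ (E.r * s))⁻¹ * ((Z : ℂ) ^ s)⁻¹) := by
    rw [hΩ, Complex.ofReal_mul, Complex.mul_cpow_ofReal_nonneg (by positivity) (by positivity),
      Complex.ofReal_mul, Complex.mul_cpow_ofReal_nonneg (by positivity) (by positivity),
      hinv _ (by positivity), hinv _ hZpos.le, hpow _ _ hrE.le, hpow _ _ hrD.le]
    simp
  have hZs : (Z : ℂ) ^ s' = ((Z ^ (-(E.ρ / E.r)) : ℝ) : ℂ) * ((Z : ℂ) ^ s)⁻¹ := by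
    rw [hss, Complex.cpow_sub _ _ (by exact_mod_cast hZpos.ne'), Complex.ofReal_cpow hZpos.le,
      Complex.ofReal_neg, div_eq_mul_inv]
  have hlow : ((lowerParams E).map fun x : ℝ => Complex.Gamma (x - s)).prod =
      (((2 * Real.pi) ^ (((E.r : ℝ) - 1) / 2) * (E.r : ℝ) ^ (1 / 2 : ℝ) : ℝ) : ℂ) *
        (E.r : ℂ) ^ (E.r * s) * Complex.Gamma (E.ρ + E.r * s') * Complex.Gamma s' := by
    have h := prod_Gamma_add_div E.r_mem (-s)
    rw [lowerParams, List.map_append, List.prod_append, List.map_map]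
    have h1 : (List.range E.r).map ((fun x : ℝ => Complex.Gamma (x - s)) ∘
        fun k : ℕ => (k : ℝ) / E.r) =
        (List.range E.r).map fun k : ℕ => Complex.Gamma (-s + (k : ℂ) / E.r) := by
      refine List.map_congr_left fun k _ => ?_
      simp only [Function.comp_apply]
      push_cast
      congr 1
      ring
    rw [h1, h]
    have h2 : (E.ρ : ℂ) + E.r * s' = E.r * -s := by
      rw [hss]; push_cast; field_simp; ring
    rw [h2]
    simp only [List.map_cons, List.map_nil, List.prod_cons, List.prod_nil, mul_one]
    rw [hss]
    simp
  have hup : (((List.range D.r).map fun k : ℕ => 1 - ζ D E - (k : ℝ) / D.r).map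
      fun x : ℝ => Complex.Gamma (1 - x + s)).prod =
      (((2 * Real.pi) ^ (((D.r : ℝ) - 1) / 2) * (D.r : ℝ) ^ (1 / 2 : ℝ) : ℝ) : ℂ) *
        (((D.r : ℝ) ^ (-(D.r * ζ D E)) : ℝ) * ((D.r : ℂ) ^ (D.r * s))⁻¹) *
          Complex.Gamma (D.ρ - D.r * s') := by
    have h := prod_Gamma_add_div D.r_mem ((ζ D E : ℂ) + s)
    rw [List.map_map]
    have h1 : (List.range D.r).map ((fun x : ℝ => Complex.Gamma (1 - x + s)) ∘
        fun k : ℕ => 1 - ζ D E - (k : ℝ) / D.r) =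
        (List.range D.r).map fun k : ℕ => Complex.Gamma ((ζ D E : ℂ) + s + (k : ℂ) / D.r) := by
      refine List.map_congr_left fun k _ => ?_
      simp only [Function.comp_apply]
      push_cast
      congr 1
      ring
    have h2 : (D.ρ : ℂ) - D.r * s' = D.r * ((ζ D E : ℂ) + s) := by
      rw [hss, ζ]; push_cast; field_simp; ring
    rw [h1, h, h2, Complex.ofReal_cpow hrD.le, ← Complex.cpow_neg, Complex.ofReal_natCast,
      ← Complex.cpow_add _ _ hrDc]
    push_cast
    congr 3
    ring
  have hΓ : Complex.Gamma s' ≠ 0 := Complex.Gamma_ne_zero hpole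
  have hcross : ((upperParams D E).drop D.r).map (fun x : ℝ => Complex.Gamma (x - s)) =
      [s' * Complex.Gamma s'] := by
    rw [upperParams, List.drop_left' (by simp)]
    simp only [List.map_cons, List.map_nil]
    rw [← Complex.Gamma_add_one _ hs', hss]
    push_cast
    congr 2
    ring
  rw [meijerIntegrand, List.take_of_length_le (l := lowerParams E) (by simp [lowerParams]),
    List.drop_of_length_le (l := lowerParams E) (by simp [lowerParams]), hcross, hlow]
  rw [upperParams, List.take_left' (by simp), hup, hΩs, hZs]
  have hconst' := congrArg Complex.ofReal hconst
  have hn1 : (D.r : ℂ) ^ (D.r * s) ≠ 0 := by simp [Complex.cpow_eq_zero_iff, hrDc]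
  have hn2 : (E.r : ℂ) ^ (E.r * s) ≠ 0 := by simp [Complex.cpow_eq_zero_iff, hrEc]
  simp only [List.map_nil, List.prod_nil, List.prod_cons, one_mul, mul_one]
  simp only [Complex.ofReal_mul (r := C * _ * _), Complex.ofReal_mul (r := C * _),
    Complex.ofReal_mul (r := C)] at hconst'
  generalize ((((2 * Real.pi) ^ (((E.r : ℝ) - 1) / 2) * (E.r : ℝ) ^ (1 / 2 : ℝ) : ℝ)) : ℂ) = A₁
    at *
  generalize ((((2 * Real.pi) ^ (((D.r : ℝ) - 1) / 2) * (D.r : ℝ) ^ (1 / 2 : ℝ) : ℝ)) : ℂ) = A₂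
    at *
  generalize (((D.r : ℝ) ^ (-(D.r * ζ D E)) : ℝ) : ℂ) = A₃ at *
  rw [Complex.ofReal_div] at hconst'
  have hg : ((Real.Gamma E.ρ * Real.Gamma D.ρ : ℝ) : ℂ) ≠ 0 := by
    exact_mod_cast (mul_pos hGE hGD).ne'
  rw [eq_div_iff hg] at hconst'
  rw [← hconst']
  field_simp

theorem opticalClosedForm_eq (D E : RISLink) (Rs : ℝ) :
    ((∫ γ, D.snrCDF (φ Rs * γ) ∂E.snrLaw : ℝ) : ℂ) = opticalClosedForm D E Rs := by
  have hex := exists_optical_line D E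
  rw [opticalClosedForm, meijerG, dif_pos hex]
  obtain ⟨hσ1, hσ2⟩ := optical_line_bounds hex.choose_spec
  set σ := hex.choose
  have hmD := D.meanY_pos
  have hmE := E.meanY_pos
  have hτD := D.τ_pos
  have hτE := E.τ_pos
  have hφ := φ_pos Rs
  rw [ζ] at hσ1
  have hσ3 : 0 < -(E.ρ / E.r) - σ := by linarith
  have hσ4 : D.r * (-(E.ρ / E.r) - σ) < D.ρ := by
    have : -(E.ρ / E.r) - σ < D.ρ / D.r := by linarith
    rwa [lt_div_iff₀ D.r_cast_pos, mul_comm] at this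
  rw [integral_snrCDF D E hφ, gamma_comparison E.ρ_pos (one_div_pos.2 E.w_pos) D.ρ_pos
    (one_div_pos.2 D.w_pos) (by positivity) E.r_pos hσ3 hσ4, mul_left_comm]
  refine congrArg _ ?_
  -- The reflection from s to s' reverses the imaginary part, hence the change of variable t ↦ -t.
  rw [← integral_const_mul, ← integral_neg_eq_self]
  refine integral_congr_ae (Filter.Eventually.of_forall fun t => ?_)
  beta_reduce
  have hre : (((-(E.ρ / E.r) - σ : ℝ) : ℂ) + ((-t : ℝ) : ℂ) * Complex.I).re =
      -(E.ρ / E.r) - σ := by simp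
  rw [optical_integrand D E (s' := ((-(E.ρ / E.r) - σ : ℝ) : ℂ) + ((-t : ℝ) : ℂ) * Complex.I)]
  · exact line_ne_zero hσ3 _
  · push_cast; ring
  · intro m h
    have h' := congrArg Complex.re h
    rw [hre] at h'
    simp at h'
    have : (0 : ℝ) ≤ m := m.cast_nonneg
    linarith

/-! ### The radio-frequency hop -/

lemma withDensity_ofReal_real {s A : Set ℝ} {f : ℝ → ℝ} (hs : MeasurableSet s)
    (hA : MeasurableSet A) (hf : Measurable f) (hnn : ∀ x ∈ s, 0 ≤ f x) :
    ((volume.restrict s).withDensity fun x => ENNReal.ofReal (f x)).real A =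
      ∫ x in A ∩ s, f x := by
  rw [measureReal_def, withDensity_apply _ hA, Measure.restrict_restrict hA,
    ← integral_eq_lintegral_of_nonneg_ae _ hf.aestronglyMeasurable]
  filter_upwards [ae_restrict_mem (hA.inter hs)] with x hx
  exact hnn x hx.2

/-! ### Bounds for the approximate Bessel coefficients -/

lemma besselV_pos {k p : ℕ} {v : ℝ} (hk : k ≤ p) (hp : 1 ≤ p) (hv : 0 < v + k + 1) :
    0 < besselV k p v := by
  have h1 : (1 : ℝ) ≤ p := by exact_mod_cast hp
  have h2 : (k : ℝ) ≤ p := by exact_mod_cast hk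
  have h3 : (0 : ℝ) ≤ k := k.cast_nonneg
  have g1 := Real.Gamma_pos_of_pos (s := (p : ℝ) + k) (by linarith)
  have g2 := Real.Gamma_pos_of_pos (s := (k : ℝ) + 1) (by linarith)
  have g3 := Real.Gamma_pos_of_pos (s := (p : ℝ) - k + 1) (by linarith)
  have g4 := Real.Gamma_pos_of_pos hv
  unfold besselV
  positivity

/-- The ratio is 1 at k = 0, and passing from k to k + 1 multiplies it by (p+k)(p-k)/p² ≤ 1.
Consequently `besselV` never exceeds the exact coefficient 1/(k! Γ(v+k+1)) of the Bessel series. -/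
lemma besselV_ratio_le_one {p : ℕ} (hp : 1 ≤ p) (k : ℕ) (hk : k ≤ p) :
    Real.Gamma ((p : ℝ) + k) * (p : ℝ) ^ (1 - 2 * (k : ℤ)) / Real.Gamma ((p : ℝ) - k + 1) ≤ 1 := by
  have h1 : (1 : ℝ) ≤ p := by exact_mod_cast hp
  have h0 : (p : ℝ) ≠ 0 := by positivity
  induction k with
  | zero =>
    simp only [Nat.cast_zero, add_zero, mul_zero, sub_zero, zpow_one]
    rw [Real.Gamma_add_one h0, mul_comm, div_self]
    exact mul_ne_zero h0 (Real.Gamma_pos_of_pos (by positivity)).ne'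
  | succ k ih =>
    have h2 : (k : ℝ) + 1 ≤ p := by exact_mod_cast hk
    have h3 : (0 : ℝ) ≤ k := k.cast_nonneg
    have ih' := ih (by omega)
    have g := Real.Gamma_pos_of_pos (s := (p : ℝ) - k) (by linarith)
    have e1 : Real.Gamma ((p : ℝ) + (k + 1 : ℕ)) = (p + k) * Real.Gamma ((p : ℝ) + k) := by
      push_cast
      rw [← add_assoc, Real.Gamma_add_one (by linarith)]
    have e2 : Real.Gamma ((p : ℝ) - k + 1) = (p - k) * Real.Gamma ((p : ℝ) - k) :=
      Real.Gamma_add_one (by linarith)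
    have e3 : (p : ℝ) - (k + 1 : ℕ) + 1 = p - k := by push_cast; ring
    have e4 : (p : ℝ) ^ (1 - 2 * ((k + 1 : ℕ) : ℤ)) = (p : ℝ) ^ (1 - 2 * (k : ℤ)) / p ^ 2 := by
      rw [show 1 - 2 * ((k + 1 : ℕ) : ℤ) = (1 - 2 * (k : ℤ)) - 2 by push_cast; ring,
        zpow_sub₀ h0]
      norm_cast
    have hpk : (0 : ℝ) < p - k := by linarith
    rw [e1, e3, e4]
    rw [e2] at ih'
    have hratio : ((p : ℝ) + k) * (p - k) / p ^ 2 ≤ 1 := by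
      rw [div_le_one (by positivity)]
      nlinarith
    have hnn : 0 ≤ ((p : ℝ) + k) * (p - k) / p ^ 2 := by positivity
    calc _ = (((p : ℝ) + k) * (p - k) / p ^ 2) *
          (Real.Gamma ((p : ℝ) + k) * (p : ℝ) ^ (1 - 2 * (k : ℤ)) /
            ((p - k) * Real.Gamma ((p : ℝ) - k))) := by field_simp
      _ ≤ ((p : ℝ) + k) * (p - k) / p ^ 2 * 1 := by gcongr
      _ ≤ 1 := by rw [mul_one]; exact hratio

lemma besselV_mul_Gamma_le {k p : ℕ} {v : ℝ} (hk : k ≤ p) (hp : 1 ≤ p) (hv : 0 < v + k + 1) :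
    besselV k p v * Real.Gamma (v + k + 1) ≤ 1 / (k.factorial : ℝ) := by
  have h := besselV_ratio_le_one hp k hk
  have g4 := Real.Gamma_pos_of_pos hv
  have hf : (0 : ℝ) < k.factorial := by exact_mod_cast k.factorial_pos
  have e : besselV k p v * Real.Gamma (v + k + 1) =
      1 / (k.factorial : ℝ) * (Real.Gamma ((p : ℝ) + k) * (p : ℝ) ^ (1 - 2 * (k : ℤ)) /
        Real.Gamma ((p : ℝ) - k + 1)) := by
    rw [besselV, Real.Gamma_nat_eq_factorial]
    field_simp
  rw [e]
  exact mul_le_of_le_one_right (by positivity) h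

namespace RFLink

variable (R : RFLink)

lemma μMRC_pos : 0 < R.μMRC := by
  have : (0 : ℝ) < R.L := by exact_mod_cast R.L_pos
  have := R.μ_pos
  unfold μMRC
  positivity

lemma B_pos : 0 < R.B := by
  have := R.μMRC_pos
  have := R.κ_pos
  unfold B
  positivity

lemma rwpβ_nonneg (i : Fin 3) : 0 ≤ rwpβ i := by
  fin_cases i <;> simp [rwpβ]

lemma measurable_distancePDF : Measurable R.distancePDF := by
  unfold distancePDF
  fun_prop

lemma distancePDF_nonneg {q : ℝ} (hq : q ∈ Set.Ioc 0 R.D) : 0 ≤ R.distancePDF q := by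
  have hD := R.D_pos
  -- The middle weight is negative, so positivity is read off from 735D⁴ - 1190D²q² + 455q⁴ = 35(D²
  -- - q²)(21D² - 13q²).
  have e : R.distancePDF q =
      35 / (72 * R.D ^ 7) * (q ^ 2 * ((R.D ^ 2 - q ^ 2) * (21 * R.D ^ 2 - 13 * q ^ 2))) := by
    simp only [distancePDF, Fin.sum_univ_three, rwpC, rwpβ, Matrix.cons_val_zero,
      Matrix.cons_val_one, Matrix.cons_val]
    norm_num
    norm_cast
    field_simp
    ring
  have h : q ^ 2 ≤ R.D ^ 2 := pow_le_pow_left₀ hq.1.le hq.2 2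
  have h1 : 0 ≤ R.D ^ 2 - q ^ 2 := by linarith
  have h2 : 0 ≤ 21 * R.D ^ 2 - 13 * q ^ 2 := by nlinarith [sq_nonneg q]
  rw [e]
  positivity

lemma integral_distancePDF {T : ℝ} (hT : 0 ≤ T) :
    ∫ q in T..R.D, R.distancePDF q =
      ∑ i, rwpC i / (rwpβ i + 1) * (1 - (T / R.D) ^ (rwpβ i + 1)) := by
  have hD := R.D_pos
  unfold distancePDF
  rw [intervalIntegral.integral_finsetSum]
  · refine Finset.sum_congr rfl fun i _ => ?_
    have hβ := rwpβ_nonneg i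
    have hp := Real.rpow_pos_of_pos hD (rwpβ i + 1)
    rw [intervalIntegral.integral_const_mul, integral_rpow (Or.inl (by linarith)),
      Real.div_rpow hT hD.le]
    field_simp
  · intro i _
    exact (intervalIntegral.intervalIntegrable_rpow' (by linarith [rwpβ_nonneg i])).const_mul _

lemma distanceLaw_univ : R.distanceLaw.real Set.univ = 1 := by
  rw [distanceLaw, withDensity_ofReal_real measurableSet_Ioc MeasurableSet.univ
    R.measurable_distancePDF fun q hq => R.distancePDF_nonneg hq, Set.univ_inter,
    ← intervalIntegral.integral_of_le R.D_pos.le, R.integral_distancePDF le_rfl]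
  simp only [Fin.sum_univ_three, rwpC, rwpβ, Matrix.cons_val_zero,
      Matrix.cons_val_one, Matrix.cons_val, zero_div]
  norm_num

lemma Ψ_pos (i : Fin 3) : 0 < R.Ψ i := by
  have := R.α_pos
  have := rwpβ_nonneg i
  unfold Ψ
  positivity

/-- Integrating q^β from T to D gives 1 - (T/D)^(β+1) up to a factor, which is the kernel with Ψ =
(β+1)/α at y = (D/T)^α; the cell boundary T ≤ D is the cutoff y ≥ 1. -/
lemma distanceLaw_Ici {T : ℝ} (hT : 0 < T) :
    R.distanceLaw.real (Set.Ici T) =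
      ∑ i, rwpC i / R.α * perronKernel (R.Ψ i) ((R.D / T) ^ R.α) := by
  have hD := R.D_pos
  have hα := R.α_pos
  rw [distanceLaw, withDensity_ofReal_real measurableSet_Ioc measurableSet_Ici
    R.measurable_distancePDF fun q hq => R.distancePDF_nonneg hq]
  have hset : Set.Ici T ∩ Set.Ioc 0 R.D = Set.Icc T R.D := by
    ext q
    simp only [Set.mem_inter_iff, Set.mem_Ici, Set.mem_Ioc, Set.mem_Icc]
    exact ⟨fun h => ⟨h.1, h.2.2⟩, fun h => ⟨h.1, hT.trans_le h.1, h.2⟩⟩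
  have hiff : 1 ≤ (R.D / T) ^ R.α ↔ T ≤ R.D := by
    rw [← one_le_div hT]
    refine ⟨fun h => ?_, fun h => Real.one_le_rpow h hα.le⟩
    by_contra h'
    exact absurd h (not_le.2 (Real.rpow_lt_one (by positivity) (not_le.1 h') hα))
  rw [hset, integral_Icc_eq_integral_Ioc]
  by_cases h : T ≤ R.D
  · rw [← intervalIntegral.integral_of_le h, R.integral_distancePDF hT.le]
    refine Finset.sum_congr rfl fun i _ => ?_
    have hβ := rwpβ_nonneg i
    rw [perronKernel, if_pos (hiff.2 h), ← Real.rpow_mul (by positivity),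
      show R.α * -R.Ψ i = -(rwpβ i + 1) by unfold Ψ; field_simp,
      Real.rpow_neg (by positivity), ← Real.inv_rpow (by positivity), inv_div, Ψ]
    field_simp
  · rw [Set.Ioc_eq_empty (fun h' => h h'.le), Measure.restrict_empty, integral_zero_measure]
    refine (Finset.sum_eq_zero fun i _ => ?_).symm
    rw [perronKernel, if_neg (fun h' => h (hiff.1 h')), mul_zero]

/-! ### The truncated fading density and its mass -/

/-- Weight of the `k`-th gamma density in the fading density. -/
noncomputable def fadingCoeff (k : ℕ) : ℝ :=
  Real.exp (-(R.μMRC * R.κ)) * besselV k R.p (R.μMRC - 1) * (R.μMRC * R.κ) ^ k *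
    R.B ^ (R.μMRC + k)

lemma fadingPowerPDF_eq {w : ℝ} (hw : 0 < w) :
    R.fadingPowerPDF w = ∑ k ∈ Finset.range (R.p + 1),
      R.fadingCoeff k * (w ^ (R.μMRC + k - 1) * Real.exp (-(R.B * w))) := by
  have hμ := R.μMRC_pos
  have hκ := R.κ_pos
  rw [fadingPowerPDF, besselApprox, Finset.mul_sum]
  refine Finset.sum_congr rfl fun k _ => ?_
  rw [fadingCoeff, A, M, B]
  generalize besselV k R.p (R.μMRC - 1) = V
  have hex : ∀ x : ℝ, 0 < x → ∃ l, x = Real.exp l := fun x hx =>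
    ⟨Real.log x, (Real.exp_log hx).symm⟩
  rw [neg_mul]
  generalize Real.exp (-(R.μMRC * (1 + R.κ) * w)) = X
  have e1 : 2 * R.μMRC * √(R.κ * (1 + R.κ)) * √w / 2 =
      R.μMRC * (√(R.κ * (1 + R.κ)) * √w) := by ring
  have e2 : 2 * R.μMRC * (1 + R.κ) ^ ((R.μMRC + 1) / 2) /
      (R.κ ^ ((R.μMRC - 1) / 2) * Real.exp (R.μMRC * R.κ)) / 2 =
      R.μMRC * (1 + R.κ) ^ ((R.μMRC + 1) / 2) /
      (R.κ ^ ((R.μMRC - 1) / 2) * Real.exp (R.μMRC * R.κ)) := by ring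
  rw [e1, e2, ← Real.rpow_natCast (R.μMRC * R.κ) k, Real.sqrt_eq_rpow, Real.sqrt_eq_rpow]
  obtain ⟨a, ha⟩ := hex R.μMRC hμ
  obtain ⟨b, hb⟩ := hex R.κ hκ
  obtain ⟨c, hc⟩ := hex (1 + R.κ) (by positivity)
  obtain ⟨d, rfl⟩ := hex w hw
  have key : R.μMRC * (1 + R.κ) ^ ((R.μMRC + 1) / 2) /
      (R.κ ^ ((R.μMRC - 1) / 2) * Real.exp (R.μMRC * R.κ)) *
      (Real.exp d ^ (1 / 2 : ℝ)) ^ (R.μMRC - 1) *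
      (R.μMRC * ((R.κ * (1 + R.κ)) ^ (1 / 2 : ℝ) * Real.exp d ^ (1 / 2 : ℝ))) ^
        (R.μMRC - 1 + 2 * (k : ℝ)) =
      Real.exp (-(R.μMRC * R.κ)) * (R.μMRC * R.κ) ^ (k : ℝ) *
        (R.μMRC * (1 + R.κ)) ^ (R.μMRC + k) * Real.exp d ^ (R.μMRC + k - 1) := by
    set m := R.μMRC * R.κ with hm
    rw [hm, Real.mul_rpow hμ.le (by positivity), Real.mul_rpow hμ.le hκ.le,
      Real.mul_rpow hμ.le (by positivity), Real.mul_rpow (by positivity) (by positivity),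
      Real.mul_rpow hκ.le (by positivity), Real.mul_rpow (by positivity) (by positivity), ← hm]
    have pa : ∀ t, R.μMRC ^ t = Real.exp (a * t) := fun t => by rw [Real.exp_mul, ← ha]
    have pb : ∀ t, R.κ ^ t = Real.exp (b * t) := fun t => by rw [Real.exp_mul, ← hb]
    have pc : ∀ t, (1 + R.κ) ^ t = Real.exp (c * t) := fun t => by rw [Real.exp_mul, ← hc]
    have pa1 : R.μMRC * (1 + R.κ) ^ ((R.μMRC + 1) / 2) =
        Real.exp a * (1 + R.κ) ^ ((R.μMRC + 1) / 2) := by rw [← ha]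
    rw [pa1]
    simp only [pa, pb, pc]
    simp only [← Real.exp_mul, ← Real.exp_add, ← Real.exp_neg, div_eq_mul_inv, one_mul]
    congr 1
    ring
  linear_combination V * X * key

lemma fadingCoeff_nonneg {k : ℕ} (hk : k ∈ Finset.range (R.p + 1)) : 0 ≤ R.fadingCoeff k := by
  have hμ := R.μMRC_pos
  have hκ := R.κ_pos
  have hB := R.B_pos
  have hV := besselV_pos (v := R.μMRC - 1) (Finset.mem_range_succ_iff.1 hk) R.p_pos
    (by have : (0 : ℝ) ≤ k := k.cast_nonneg
        linarith)
  unfold fadingCoeff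
  positivity

lemma fadingPowerPDF_nonneg {w : ℝ} (hw : w ∈ Set.Ioi (0 : ℝ)) : 0 ≤ R.fadingPowerPDF w := by
  have hw' : 0 < w := hw
  rw [R.fadingPowerPDF_eq hw']
  exact Finset.sum_nonneg fun k hk => mul_nonneg (R.fadingCoeff_nonneg hk) (by positivity)

lemma measurable_fadingPowerPDF : Measurable R.fadingPowerPDF := by
  unfold fadingPowerPDF besselApprox
  fun_prop

lemma shape_pos (k : ℕ) : 0 < R.μMRC + k :=
  add_pos_of_pos_of_nonneg R.μMRC_pos k.cast_nonneg

lemma integrableOn_fading_term (k : ℕ) :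
    IntegrableOn (fun w : ℝ => w ^ (R.μMRC + k - 1) * Real.exp (-(R.B * w))) (Set.Ioi 0) :=
  integrableOn_rpow_mul_exp_neg (by linarith [R.shape_pos k]) R.B_pos

lemma integrableOn_fadingPowerPDF : IntegrableOn R.fadingPowerPDF (Set.Ioi 0) := by
  refine IntegrableOn.congr_fun (f := fun w => ∑ k ∈ Finset.range (R.p + 1),
      R.fadingCoeff k * (w ^ (R.μMRC + k - 1) * Real.exp (-(R.B * w)))) ?_
    (fun w hw => (R.fadingPowerPDF_eq hw).symm) measurableSet_Ioi
  exact integrable_finsetSum _ fun k _ => (R.integrableOn_fading_term k).const_mul _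

/-- The mass of the k-th gamma term is at most the Poisson weight e^(-m) m^k/k! with m = Lμκ, and
the Poisson weights sum to 1. -/
lemma fadingPowerLaw_univ_le : R.fadingPowerLaw.real Set.univ ≤ 1 := by
  have hμ := R.μMRC_pos
  have hκ := R.κ_pos
  have hB := R.B_pos
  rw [fadingPowerLaw, withDensity_ofReal_real measurableSet_Ioi MeasurableSet.univ
    R.measurable_fadingPowerPDF fun w hw => R.fadingPowerPDF_nonneg hw, Set.univ_inter,
    setIntegral_congr_fun measurableSet_Ioi fun w hw => R.fadingPowerPDF_eq hw,
    integral_finsetSum _ fun k _ => (R.integrableOn_fading_term k).const_mul _]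
  have hle : ∀ k ∈ Finset.range (R.p + 1),
      ∫ w in Set.Ioi 0, R.fadingCoeff k * (w ^ (R.μMRC + k - 1) * Real.exp (-(R.B * w))) ≤
        Real.exp (-(R.μMRC * R.κ)) * ((R.μMRC * R.κ) ^ k / k.factorial) := by
    intro k hk
    have hs := R.shape_pos k
    have hV := besselV_mul_Gamma_le (v := R.μMRC - 1) (Finset.mem_range_succ_iff.1 hk) R.p_pos
      (by linarith)
    rw [show R.μMRC - 1 + k + 1 = R.μMRC + k by ring] at hV
    rw [integral_const_mul, Real.integral_rpow_mul_exp_neg_mul_Ioi hs hB, fadingCoeff,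
      one_div, Real.inv_rpow hB.le]
    have hBp := Real.rpow_pos_of_pos hB (R.μMRC + k)
    calc _ = Real.exp (-(R.μMRC * R.κ)) * (R.μMRC * R.κ) ^ k *
          (besselV k R.p (R.μMRC - 1) * Real.Gamma (R.μMRC + k)) := by field_simp
      _ ≤ Real.exp (-(R.μMRC * R.κ)) * (R.μMRC * R.κ) ^ k * (1 / k.factorial) := by gcongr
      _ = _ := by ring
  refine (Finset.sum_le_sum hle).trans ?_
  rw [← Finset.mul_sum, Real.exp_neg, inv_mul_le_one₀ (Real.exp_pos _)]
  exact Real.sum_le_exp_of_nonneg (by positivity) _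

lemma isFiniteMeasure_distanceLaw : IsFiniteMeasure R.distanceLaw := by
  refine ⟨lt_top_iff_ne_top.2 fun h => ?_⟩
  have := R.distanceLaw_univ
  rw [measureReal_def, h] at this
  simp at this

lemma isFiniteMeasure_fadingPowerLaw : IsFiniteMeasure R.fadingPowerLaw := by
  refine ⟨?_⟩
  rw [fadingPowerLaw, withDensity_apply _ MeasurableSet.univ, Measure.restrict_univ]
  exact R.integrableOn_fadingPowerPDF.lintegral_lt_top

lemma measurable_snr :
    Measurable fun x : ℝ × ℝ => R.ϱ * x.1 ^ (-R.α) * (R.L * R.γbar) * x.2 := by fun_prop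

lemma snrCDF_le_one (x : ℝ) : R.snrCDF x ≤ 1 := by
  have := R.isFiniteMeasure_distanceLaw
  have := R.isFiniteMeasure_fadingPowerLaw
  rw [snrCDF, snrLaw, map_measureReal_apply R.measurable_snr measurableSet_Iic]
  refine (measureReal_mono (Set.subset_univ _)).trans ?_
  rw [← Set.univ_prod_univ, measureReal_prod_prod, R.distanceLaw_univ, one_mul]
  exact R.fadingPowerLaw_univ_le

/-- Given the fading power w, the event γ_R ≤ x says that the relay is far enough, q ≥ T with T^α =
ϱLγ̄w/x. Its probability is the tail in `distanceLaw_Ici`, and the fading density is then expanded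
into gamma terms. -/
lemma snrCDF_eq {x : ℝ} (hx : 0 < x) :
    R.snrCDF x = ∑ i, ∑ k ∈ Finset.range (R.p + 1), rwpC i / R.α * R.fadingCoeff k *
      ∫ w in Set.Ioi 0, w ^ (R.μMRC + k - 1) * Real.exp (-(R.B * w)) *
        perronKernel (R.Ψ i) (x * R.D ^ R.α / (R.ϱ * R.L * R.γbar) * w⁻¹) := by
  have := R.isFiniteMeasure_distanceLaw
  have := R.isFiniteMeasure_fadingPowerLaw
  have hL : (0 : ℝ) < R.L := by exact_mod_cast R.L_pos
  have hϱ := R.ϱ_pos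
  have hγ := R.γbar_pos
  have hα := R.α_pos
  have hD := R.D_pos
  set S : Set (ℝ × ℝ) := (fun z : ℝ × ℝ => R.ϱ * z.1 ^ (-R.α) * (R.L * R.γbar) * z.2) ⁻¹' Set.Iic x
    with hS
  have hSm : MeasurableSet S := R.measurable_snr measurableSet_Iic
  have h1 : R.snrCDF x = ∫ w, R.distanceLaw.real {q | (q, w) ∈ S} ∂(R.fadingPowerLaw) := by
    rw [snrCDF, snrLaw, map_measureReal_apply R.measurable_snr measurableSet_Iic, ← hS,
      ← integral_indicator_one hSm, integral_prod_symm]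
    · refine integral_congr_ae (Filter.Eventually.of_forall fun w => ?_)
      have hm : MeasurableSet {q | (q, w) ∈ S} := measurable_prodMk_right hSm
      beta_reduce
      rw [← integral_indicator_one hm]
      rfl
    · exact (integrable_const (1 : ℝ)).indicator hSm
  have hsec : ∀ w : ℝ, 0 < w → R.distanceLaw.real {q | (q, w) ∈ S} =
      ∑ i, rwpC i / R.α *
        perronKernel (R.Ψ i) (x * R.D ^ R.α / (R.ϱ * R.L * R.γbar) * w⁻¹) := by
    intro w hw
    set c : ℝ := R.ϱ * R.L * R.γbar with hc
    have hcpos : 0 < c := by positivity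
    set T : ℝ := (c * w / x) ^ (1 / R.α) with hT
    have hTpos : 0 < T := by positivity
    have hTα : T ^ R.α = c * w / x := by
      rw [hT, ← Real.rpow_mul (by positivity), one_div, inv_mul_cancel₀ hα.ne', Real.rpow_one]
    have hae : ∀ᵐ q ∂(R.distanceLaw), 0 < q := by
      refine (withDensity_absolutelyContinuous _ _).ae_le ?_
      filter_upwards [ae_restrict_mem measurableSet_Ioc] with q hq
      exact hq.1
    have hcongr : ({q | (q, w) ∈ S} : Set ℝ) =ᵐ[R.distanceLaw] Set.Ici T := by
      filter_upwards [hae] with q hq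
      refine propext ?_
      change R.ϱ * q ^ (-R.α) * (R.L * R.γbar) * w ≤ x ↔ T ≤ q
      have hqα := Real.rpow_pos_of_pos hq R.α
      rw [← Real.rpow_le_rpow_iff hTpos.le hq.le hα, hTα, Real.rpow_neg hq.le,
        show R.ϱ * (q ^ R.α)⁻¹ * (R.L * R.γbar) * w = c * w / q ^ R.α by rw [hc]; field_simp,
        div_le_iff₀ hqα, div_le_iff₀ hx, mul_comm x]
    rw [measureReal_congr hcongr, R.distanceLaw_Ici hTpos]
    refine Finset.sum_congr rfl fun i _ => ?_
    rw [Real.div_rpow hD.le hTpos.le, hTα]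
    congr 2
    field_simp
  have hterm : ∀ (i : Fin 3) (k : ℕ), IntegrableOn (fun w : ℝ => rwpC i / R.α * R.fadingCoeff k *
      (w ^ (R.μMRC + k - 1) * Real.exp (-(R.B * w)) *
        perronKernel (R.Ψ i) (x * R.D ^ R.α / (R.ϱ * R.L * R.γbar) * w⁻¹))) (Set.Ioi 0) := by
    intro i k
    refine Integrable.const_mul ?_ _
    refine ((R.integrableOn_fading_term k).norm.mul_const (1 / R.Ψ i)).mono' ?_ ?_
    · refine Measurable.aestronglyMeasurable ?_
      have := (measurable_perronKernel (R.Ψ i)).comp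
        (measurable_const.mul measurable_inv : Measurable fun w : ℝ =>
          x * R.D ^ R.α / (R.ϱ * R.L * R.γbar) * w⁻¹)
      exact Measurable.mul (by fun_prop) this
    · refine Filter.Eventually.of_forall fun w => ?_
      rw [norm_mul, Real.norm_of_nonneg (perronKernel_nonneg (R.Ψ_pos i) _)]
      gcongr
      exact perronKernel_le (R.Ψ_pos i) _
  rw [h1, fadingPowerLaw, integral_withDensity_eq_integral_toReal_smul
    R.measurable_fadingPowerPDF.ennreal_ofReal
    (Filter.Eventually.of_forall fun _ => ENNReal.ofReal_lt_top)]
  simp_rw [← integral_const_mul]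
  rw [← Finset.sum_congr rfl fun i _ => integral_finsetSum _ fun k _ => hterm i k,
    ← integral_finsetSum _ fun i _ => integrable_finsetSum _ fun k _ => hterm i k]
  refine setIntegral_congr_fun measurableSet_Ioi fun w hw => ?_
  simp only [smul_eq_mul]
  rw [ENNReal.toReal_ofReal (R.fadingPowerPDF_nonneg hw), hsec w hw, R.fadingPowerPDF_eq hw,
    Finset.sum_mul_sum, Finset.sum_comm]
  refine Finset.sum_congr rfl fun i _ => Finset.sum_congr rfl fun k _ => ?_
  ring

/-! ### The Meijer G-function of the radio-frequency hop -/

lemma exists_rf_line {m Ψ : ℝ} (hm : 0 < m) (hΨ : 0 < Ψ) :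
    ∃ σ : ℝ, IsMeijerLine 1 2 [1 - Ψ, 1] [m, 0, -Ψ] σ := by
  refine ⟨m / 2, ?_, ?_⟩
  · intro x hx
    simp only [List.take_succ_cons, List.take_zero, List.mem_cons, List.not_mem_nil,
      or_false] at hx
    rcases hx with rfl | rfl <;> linarith
  · intro x hx
    simp only [List.take_succ_cons, List.take_zero, List.mem_cons, List.not_mem_nil,
      or_false] at hx
    rw [hx]
    linarith

/-- The quotients Γ(s)/Γ(s+1) and Γ(s+Ψ)/Γ(s+Ψ+1) collapse to the transform of the kernel. -/
lemma rf_integrand {m Ψ z : ℝ} {s : ℂ} (hΨ : 0 < Ψ) (hs : 0 < s.re) :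
    meijerIntegrand 1 2 [1 - Ψ, 1] [m, 0, -Ψ] z s =
      (s * (s + Ψ))⁻¹ * ((z : ℂ) ^ s * Complex.Gamma (m - s)) := by
  have hs0 : s ≠ 0 := by rintro rfl; simp at hs
  have hs1 : s + Ψ ≠ 0 := by
    intro h
    have := congrArg Complex.re h
    simp at this
    linarith
  have g0 : Complex.Gamma s ≠ 0 := Complex.Gamma_ne_zero_of_re_pos hs
  have g1 : Complex.Gamma (s + Ψ) ≠ 0 :=
    Complex.Gamma_ne_zero_of_re_pos (by simp; linarith)
  simp only [meijerIntegrand, List.take_succ_cons, List.take_zero, List.drop_succ_cons,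
    List.drop_zero, List.map_cons, List.map_nil, List.prod_cons, List.prod_nil, mul_one]
  rw [show (1 : ℂ) - ((1 - Ψ : ℝ) : ℂ) + s = s + Ψ by push_cast; ring,
    show (1 : ℂ) - ((1 : ℝ) : ℂ) + s = s by push_cast; ring,
    show (1 : ℂ) - ((0 : ℝ) : ℂ) + s = s + 1 by push_cast; ring,
    show (1 : ℂ) - ((-Ψ : ℝ) : ℂ) + s = (s + Ψ) + 1 by push_cast; ring,
    Complex.Gamma_add_one _ hs0, Complex.Gamma_add_one _ hs1]
  field_simp

/-- The Meijer G-function of the radio-frequency hop as a gamma integral. -/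
lemma rf_meijerG {m Ψ B c : ℝ} (hm : 0 < m) (hΨ : 0 < Ψ) (hB : 0 < B) (hc : 0 < c) :
    meijerG 1 2 [1 - Ψ, 1] [m, 0, -Ψ] (B * c) =
      ((B ^ m * ∫ w in Set.Ioi 0, w ^ (m - 1) * Real.exp (-(B * w)) *
        perronKernel Ψ (c * w⁻¹) : ℝ) : ℂ) := by
  have hex := exists_rf_line hm hΨ
  rw [meijerG, dif_pos hex]
  have hσ := hex.choose_spec
  set σ := hex.choose
  have hσ0 : 0 < σ := by simpa using hσ.1 1 (by simp)
  have hσm : σ < m := hσ.2 m (by simp)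
  have hpos : ∀ᵐ w : ℝ ∂volume.restrict (Set.Ioi 0), 0 < c * w⁻¹ := by
    filter_upwards [ae_restrict_mem measurableSet_Ioi] with w hw
    have : 0 < w := hw
    positivity
  have hint : Integrable (fun w : ℝ => w ^ (m - 1) * Real.exp (-(B * w)) * (c * w⁻¹) ^ σ)
      (volume.restrict (Set.Ioi 0)) := by
    refine IntegrableOn.congr_fun ((integrableOn_rpow_mul_exp_neg (q := m - 1 - σ)
      (by linarith) hB).const_mul (c ^ σ)) (fun w hw => ?_) measurableSet_Ioi
    have hw' : 0 < w := hw
    rw [Real.mul_rpow hc.le (by positivity), Real.inv_rpow hw'.le, Real.rpow_sub hw']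
    field_simp
  have key := perron_integral (volume.restrict (Set.Ioi (0 : ℝ))) hΨ hσ0
    (wt := fun w => w ^ (m - 1) * Real.exp (-(B * w))) (Y := fun w => c * w⁻¹)
    (by fun_prop) (by fun_prop) hpos hint
  rw [Complex.ofReal_mul, ← key, mul_left_comm]
  refine congrArg _ ?_
  rw [← integral_const_mul]
  refine integral_congr_ae (Filter.Eventually.of_forall fun t => ?_)
  beta_reduce
  set s : ℂ := σ + t * Complex.I with hs
  have hsre : s.re = σ := by simp [hs]
  have hBc : (B : ℂ) ≠ 0 := by exact_mod_cast hB.ne'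
  have hmom : ∫ w in Set.Ioi 0, ((w ^ (m - 1) * Real.exp (-(B * w)) : ℝ) : ℂ) *
      ((c * w⁻¹ : ℝ) : ℂ) ^ s = (c : ℂ) ^ s * ((B : ℂ) ^ (-((m : ℂ) + -s)) *
        Complex.Gamma (m + -s)) := by
    rw [← integral_cpow_gamma (by simp [hsre]; linarith) hB, ← integral_const_mul]
    refine setIntegral_congr_fun measurableSet_Ioi fun w hw => ?_
    have hw' : 0 < w := hw
    rw [Complex.ofReal_mul c, Complex.mul_cpow_ofReal_nonneg hc.le (by positivity),
      Complex.ofReal_inv, Complex.inv_cpow, Complex.cpow_neg]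
    · ring
    · rw [Complex.arg_ofReal_of_nonneg hw'.le]
      exact Real.pi_pos.ne
  rw [rf_integrand hΨ (by rw [hsre]; exact hσ0), hmom, Complex.ofReal_mul,
    Complex.mul_cpow_ofReal_nonneg hB.le hc.le, Complex.ofReal_cpow hB.le,
    show -((m : ℂ) + -s) = s - m by ring, Complex.cpow_sub _ _ hBc, sub_eq_add_neg]
  have hn : (B : ℂ) ^ (m : ℂ) ≠ 0 := by simp [Complex.cpow_eq_zero_iff, hBc]
  field_simp

theorem snrCDF_eq_cdfClosedForm {x : ℝ} (hx : 0 < x) :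
    ((R.snrCDF x : ℝ) : ℂ) = R.cdfClosedForm x := by
  have hL : (0 : ℝ) < R.L := by exact_mod_cast R.L_pos
  have hϱ := R.ϱ_pos
  have hγ := R.γbar_pos
  have hD := R.D_pos
  have hα := R.α_pos
  have hB := R.B_pos
  rw [R.snrCDF_eq hx, cdfClosedForm, Complex.ofReal_sum]
  refine Finset.sum_congr rfl fun i _ => ?_
  rw [Complex.ofReal_sum]
  refine Finset.sum_congr rfl fun k _ => ?_
  have hμ : (R.L * R.μ : ℝ) = R.μMRC := rfl
  have hz : R.K₂ * x = R.B * (x * R.D ^ R.α / (R.ϱ * R.L * R.γbar)) := by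
    rw [K₂]; ring
  rw [hμ, hz, rf_meijerG (R.shape_pos k) (R.Ψ_pos i) hB (by positivity), ← Complex.ofReal_mul]
  congr 1
  rw [K₁, fadingCoeff, hμ, Real.exp_neg]
  generalize ∫ w in Set.Ioi 0, w ^ (R.μMRC + k - 1) * Real.exp (-(R.B * w)) *
    perronKernel (R.Ψ i) (x * R.D ^ R.α / (R.ϱ * R.L * R.γbar) * w⁻¹) = I
  field_simp

end RFLink

/-! ### The lower bound and the conclusion -/

theorem sopLower_le_sop (R : RFLink) (D E : RISLink) {Rs : ℝ} (hRs : 0 < Rs) :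
    sopLower R D E Rs ≤ sop R D E Rs := by
  have := D.isProbabilityMeasure_snrLaw
  have := E.isProbabilityMeasure_snrLaw
  have hφ := one_lt_φ hRs
  have hint : ∀ a : ℝ, Integrable (fun γ => D.snrCDF (φ Rs * γ + a)) E.snrLaw := by
    intro a
    refine Integrable.of_bound (C := 1) ?_ (Filter.Eventually.of_forall fun γ => ?_)
    · exact (D.monotone_snrCDF.measurable.comp (by fun_prop)).aestronglyMeasurable
    · rw [RISLink.snrCDF, Real.norm_of_nonneg measureReal_nonneg]
      exact measureReal_le_one
  unfold sopLower sop
  -- The sign of this factor is what lets the comparison of the two integrals pass to the outage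
  -- probabilities.
  have h1 : 0 ≤ 1 - R.snrCDF (φ Rs - 1) := sub_nonneg.2 (R.snrCDF_le_one _)
  gcongr
  · simpa using hint 0
  · simpa [add_sub_assoc] using hint (φ Rs - 1)
  · intro γ
    refine D.monotone_snrCDF ?_
    linarith

end RFUOWC

theorem mainTheorem6 (R : RFUOWC.RFLink) (D E : RFUOWC.RISLink) (Rs : ℝ) (hRs : 0 < Rs) :
    RFUOWC.sopLower R D E Rs ≤ RFUOWC.sop R D E Rs ∧
    (RFUOWC.sopLower R D E Rs : ℂ) =
      RFUOWC.opticalClosedForm D E Rs * (1 - R.cdfClosedForm (RFUOWC.φ Rs - 1)) +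
        R.cdfClosedForm (RFUOWC.φ Rs - 1) := by
  refine ⟨RFUOWC.sopLower_le_sop R D E hRs, ?_⟩
  rw [← R.snrCDF_eq_cdfClosedForm (sub_pos.2 (RFUOWC.one_lt_φ hRs)),
    ← RFUOWC.opticalClosedForm_eq, RFUOWC.sopLower]
  push_cast
  ring
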